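/- **Model.** Fix $\lambda>0$, $\beta>0$, $\alpha_L>0$, $\alpha_N>2$, $\theta\in[0,\pi]$, antenna gains $G>0$ (main lobe) and $g\ge 0$ (back lobe), transmit power $P_t>0$, path-loss intercept $A>0$, noise power $N_0>0$ (all in linear units), link length $r>0$ and an integer $N_h\ge 1$. Put $\ell_p(x)=e^{-\beta x}$ and $G_0=G^2$. The typical receiver is at the origin. The interferers form a homogeneous Poisson point process $\Phi=\{X_i\}$ on $\mathbb R^2$ with intensity $\lambda$; write $d_i=\|X_i\|$. Given $\Phi$, the following marks are independent over the interferers and of each other: the path-loss exponent $\alpha_i$, equal to $\alpha_L$ (LOS) with probability $\ell_p(d_i)$ and to $\alpha_N$ (NLOS) with probability $1-\ell_p(d_i)$; the antenna gain, equal to $M_{GG}=G^2$, $M_{Gg}=Gg$, $M_{gg}=g^2$ with probabilities $$p_{GG}=\Big(\frac{\theta}{\pi}\Big)^2,\qquad p_{Gg}=2\,\frac{\theta}{\pi}\,\frac{\pi-\theta}{\pi},\qquad p_{gg}=\Big(\frac{\pi-\theta}{\pi}\Big)^2;$$ and the fading power $h_i\sim\Gamma(N_h,1/N_h)$ (shape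 $N_h$, scale $1/N_h$). Independently of all this, the typical link of length $r$ has fading power $h_0\sim\Gamma(N_h,1/N_h)$ and, independently of $h_0$, path-loss exponent $\alpha_0=\alpha_L$ (LOS) with probability $\ell_p(r)$ and $\alpha_0=\alpha_N$ (NLOS) with probability $1-\ell_p(r)$. With $M_i$ now the gain of interferer $i$, let $$\mathrm{SINR}=\frac{P_tG_0h_0Ar^{-\alpha_0}}{N_0+\sum_{i\in\Phi}P_tM_ih_iAd_i^{-\alpha_i}},\qquad P_c(T)=\mathbb P[\mathrm{SINR}\ge T].$$ **Theorem 1.** Let $T>0$, $a=N_h(N_h!)^{-1/N_h}$ and, for $j\in\{L,N\}$ and $i\in\{GG,Gg,gg\}$, $$K_j=\frac{a r^{\alpha_j}}{P_tG_0A},\qquad Q_{j,i}=\frac{a r^{\alpha_j}M_i}{G_0}.$$ For $n\ge 1$ put $$\kappa_L=\sum_i p_i\int_0^\infty\Big[1-\Big(1+\frac{nQ_{L,i}T}{x^{\alpha_L}N_h}\Big)^{-N_h}\Big]\ell_p(x)\,x\,dx,\qquad \kappa_N=\sum_i p_i\int_0^\infty\Big[1-\Big(1+\frac{nQ_{L,i}T}{x^{\alpha_N}N_h}\Big)^{-N_h}\Big](1-\ell_p(x))\,x\,dx,$$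 $$\xi_L=\sum_i p_i\int_0^\infty\Big[1-\Big(1+\frac{nQ_{N,i}T}{x^{\alpha_L}N_h}\Big)^{-N_h}\Big]\ell_p(x)\,x\,dx,\qquad \xi_N=\sum_i p_i\int_0^\infty\Big[1-\Big(1+\frac{nQ_{N,i}T}{x^{\alpha_N}N_h}\Big)^{-N_h}\Big](1-\ell_p(x))\,x\,dx.$$ All these integrals converge, and if $N_h\ge 2$ then $$P_c(T)<\ell_p(r)\sum_{n=1}^{N_h}\binom{N_h}{n}(-1)^{n+1}e^{-nK_LTN_0}e^{-2\pi\lambda(\kappa_L+\kappa_N)}+(1-\ell_p(r))\sum_{n=1}^{N_h}\binom{N_h}{n}(-1)^{n+1}e^{-nK_NTN_0}e^{-2\pi\lambda(\xi_L+\xi_N)}.$$ If $N_h=1$, equality holds instead. -/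

import Mathlib

open MeasureTheory ProbabilityTheory
open scoped ENNReal

noncomputable section

namespace MmWave

/-- The three possible combinations of transmit and receive lobes on an interfering link. -/
inductive Lobes where
  | GG
  | Gg
  | gg
  deriving DecidableEq

instance : Fintype Lobes where
  elems := {.GG, .Gg, .gg}
  complete := by intro x; cases x <;> decide

instance : MeasurableSpace Lobes := ⊤

/-- The parameters of the network, all in linear units. -/
structure Params where
  /-- effective intensity of the Poisson process of interferers -/
  intensity : ℝ
  /-- blockage parameter -/
  β : ℝ
  /-- LOS path-loss exponent -/
  αL : ℝ
  /-- NLOS path-loss exponent -/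
  αN : ℝ
  /-- beamwidth -/
  θ : ℝ
  /-- main lobe gain -/
  G : ℝ
  /-- back lobe gain -/
  g : ℝ
  /-- transmit power -/
  Pt : ℝ
  /-- path-loss intercept -/
  A : ℝ
  /-- noise power -/
  N0 : ℝ
  /-- length of the typical dipole link -/
  r : ℝ
  /-- Nakagami parameter -/
  Nh : ℕ
  intensity_pos : 0 < intensity
  β_pos : 0 < β
  αL_pos : 0 < αL
  αN_gt : 2 < αN
  θ_nonneg : 0 ≤ θ
  θ_le : θ ≤ Real.pi
  G_pos : 0 < G
  g_nonneg : 0 ≤ g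
  Pt_pos : 0 < Pt
  A_pos : 0 < A
  N0_pos : 0 < N0
  r_pos : 0 < r
  Nh_pos : 1 ≤ Nh

/-- The Euclidean plane. -/
abbrev Plane : Type := EuclideanSpace ℝ (Fin 2)

/-- The marks of an interferer: whether its link is LOS, its lobes, and its fading power. -/
abbrev Mark : Type := Bool × Lobes × ℝ

namespace Params

variable (P : Params)

/-- The probability `ℓ_p(x)` that a link of length `x` is LOS. -/
def losProb (x : ℝ) : ℝ := Real.exp (-P.β * x)

/-- The path-loss exponent of a link that is LOS (`true`) or NLOS (`false`). -/
def pathLoss (los : Bool) : ℝ := if los then P.αL else P.αN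

/-- The probability that a link of length `x` has the given state. -/
def stateProb (los : Bool) (x : ℝ) : ℝ := if los then P.losProb x else 1 - P.losProb x

/-- The antenna gain `M_i` of an interfering link. -/
def gain : Lobes → ℝ
  | .GG => P.G * P.G
  | .Gg => P.G * P.g
  | .gg => P.g * P.g

/-- The antenna gain of the typical link: both main lobes are aligned. -/
def G0 : ℝ := P.G * P.G

/-- The probability `p_i` of each lobe combination. -/
def gainProb : Lobes → ℝ
  | .GG => (P.θ / Real.pi) ^ 2
  | .Gg => 2 * (P.θ / Real.pi) * ((Real.pi - P.θ) / Real.pi)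
  | .gg => ((Real.pi - P.θ) / Real.pi) ^ 2

/-- Law of the blockage state of a link of length `x`. -/
def stateLaw (x : ℝ) : Measure Bool :=
  ∑ b : Bool, ENNReal.ofReal (P.stateProb b x) • Measure.dirac b

/-- Law of the lobe combination of an interfering link. -/
def lobesLaw : Measure Lobes :=
  ∑ c : Lobes, ENNReal.ofReal (P.gainProb c) • Measure.dirac c

/-- Law of the fading power: gamma with shape `N_h` and scale `1 / N_h`, that is, rate `N_h`. -/
def fadingLaw : Measure ℝ := gammaMeasure P.Nh P.Nh

/-- Law of the marks of an interferer located at `x`, the receiver being at the origin. -/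
def markLaw (x : Plane) : Measure Mark :=
  (P.stateLaw ‖x‖).prod (P.lobesLaw.prod P.fadingLaw)

/-- Law of the blockage state and the fading power of the typical link. -/
def typicalLaw : Measure (Bool × ℝ) := (P.stateLaw P.r).prod P.fadingLaw

/-- `a = N_h (N_h!)^{-1/N_h}`. -/
def a : ℝ := P.Nh * (P.Nh.factorial : ℝ) ^ (-1 / (P.Nh : ℝ))

/-- `K_L` (for `true`) and `K_N` (for `false`). -/
def K (los₀ : Bool) : ℝ := P.a * P.r ^ P.pathLoss los₀ / (P.Pt * P.G0 * P.A)

/-- `Q_L` (for `true`) and `Q_N` (for `false`) for an interferer with lobes `i`. -/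
def Q (los₀ : Bool) (i : Lobes) : ℝ := P.a * P.r ^ P.pathLoss los₀ * P.gain i / P.G0

/-- The integrand of the exponents, for a typical link of state `los₀` and interferers of
state `los` with lobes `i`. -/
def integrand (T : ℝ) (n : ℕ) (los₀ los : Bool) (i : Lobes) (x : ℝ) : ℝ :=
  (1 - 1 / (1 + n * P.Q los₀ i * T / (x ^ P.pathLoss los * P.Nh)) ^ P.Nh)
    * P.stateProb los x * x

/-- Contribution of the interferers of state `los` to the exponent, for a typical link of
state `los₀`. -/
def exponent (T : ℝ) (n : ℕ) (los₀ los : Bool) : ℝ :=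
  ∑ i : Lobes, P.gainProb i * ∫ x in Set.Ioi (0 : ℝ), P.integrand T n los₀ los i x

/-- LOS interference, LOS typical link. -/
def κL (T : ℝ) (n : ℕ) : ℝ := P.exponent T n true true

/-- NLOS interference, LOS typical link. -/
def κN (T : ℝ) (n : ℕ) : ℝ := P.exponent T n true false

/-- LOS interference, NLOS typical link. -/
def ξL (T : ℝ) (n : ℕ) : ℝ := P.exponent T n false true

/-- NLOS interference, NLOS typical link. -/
def ξN (T : ℝ) (n : ℕ) : ℝ := P.exponent T n false false

/-- The bound on the CCDF of the SINR. -/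
def ccdfBound (T : ℝ) : ℝ :=
  (∑ n ∈ Finset.Icc 1 P.Nh, (P.Nh.choose n : ℝ) * (-1) ^ (n + 1)
      * Real.exp (-(n * P.K true * T * P.N0))
      * Real.exp (-(2 * Real.pi * P.intensity * (P.κL T n + P.κN T n)))) * P.losProb P.r
  + (∑ n ∈ Finset.Icc 1 P.Nh, (P.Nh.choose n : ℝ) * (-1) ^ (n + 1)
      * Real.exp (-(n * P.K false * T * P.N0))
      * Real.exp (-(2 * Real.pi * P.intensity * (P.ξL T n + P.ξN T n)))) * (1 - P.losProb P.r)

end Params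

/-- The random points `X 0, X 1, …` enumerate a homogeneous Poisson point process of the given
intensity on the plane: the numbers of points in disjoint bounded Borel sets are independent
and Poisson distributed with mean the intensity times the area. -/
structure IsPoissonProcess {Ω : Type*} [MeasurableSpace Ω] (μ : Measure Ω) (intensity : ℝ)
    (X : ℕ → Ω → Plane) : Prop where
  measurable : ∀ i, Measurable (X i)
  counts : ∀ (m : ℕ) (B : Fin m → Set Plane) (k : Fin m → ℕ),
    (∀ j, MeasurableSet (B j)) → (∀ j, Bornology.IsBounded (B j)) →
    Pairwise (fun j j' => Disjoint (B j) (B j')) →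
    μ {ω | ∀ j, {i | X i ω ∈ B j}.encard = k j} =
      ∏ j, ENNReal.ofReal (Real.exp (-(intensity * (volume (B j)).toReal))
        * (intensity * (volume (B j)).toReal) ^ k j / (k j).factorial)

/-- A realization of the network on a probability space, seen from the typical receiver at the
origin. -/
structure Network (P : Params) {Ω : Type*} [MeasurableSpace Ω] (μ : Measure Ω) where
  /-- locations of the interferers -/
  X : ℕ → Ω → Plane
  /-- whether the link from each interferer is LOS -/
  los : ℕ → Ω → Bool
  /-- lobes on the link from each interferer -/
  lobes : ℕ → Ω → Lobes
  /-- fading power on the link from each interferer -/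
  h : ℕ → Ω → ℝ
  /-- whether the typical link is LOS -/
  los₀ : Ω → Bool
  /-- fading power of the typical link -/
  h₀ : Ω → ℝ
  poisson : IsPoissonProcess μ P.intensity X
  measurable_los : ∀ i, Measurable (los i)
  measurable_lobes : ∀ i, Measurable (lobes i)
  measurable_h : ∀ i, Measurable (h i)
  measurable_los₀ : Measurable los₀
  measurable_h₀ : Measurable h₀
  /-- Conditionally on the locations, the marks of the interferers are independent, the mark at
  `x` having law `P.markLaw x`; the typical link is independent of all this and has law
  `P.typicalLaw`. -/
  law : ∀ (s : Finset ℕ) (B : Set (ℕ → Plane)) (E : ℕ → Set Mark) (D : Set (Bool × ℝ)),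
    MeasurableSet B → (∀ i, MeasurableSet (E i)) → MeasurableSet D →
    μ {ω | (fun i => X i ω) ∈ B ∧ (∀ i ∈ s, (los i ω, lobes i ω, h i ω) ∈ E i)
        ∧ (los₀ ω, h₀ ω) ∈ D} =
      (∫⁻ ω in {ω | (fun i => X i ω) ∈ B}, ∏ i ∈ s, P.markLaw (X i ω) (E i) ∂μ)
        * P.typicalLaw D

namespace Network

variable {P : Params} {Ω : Type*} [MeasurableSpace Ω] {μ : Measure Ω} (N : Network P μ)

/-- Received power of the desired signal. -/
def signal (ω : Ω) : ℝ :=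
  P.Pt * P.G0 * N.h₀ ω * P.A * P.r ^ (-P.pathLoss (N.los₀ ω))

/-- Total received interference power, a sum of nonnegative terms in `[0, ∞]`. -/
def interference (ω : Ω) : ℝ≥0∞ :=
  ∑' i, ENNReal.ofReal (P.Pt * P.gain (N.lobes i ω) * N.h i ω * P.A
    * ‖N.X i ω‖ ^ (-P.pathLoss (N.los i ω)))

/-- The signal to interference plus noise ratio. -/
def SINR (ω : Ω) : ℝ≥0∞ :=
  ENNReal.ofReal (N.signal ω) / (ENNReal.ofReal P.N0 + N.interference ω)

/-- The CCDF `P_c(T)` of the SINR. -/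
def ccdf (T : ℝ) : ℝ := μ.real {ω | ENNReal.ofReal T ≤ N.SINR ω}

end Network

end MmWave

end

/-! Fix the interference `I` and the state `j` of the typical link. Coverage is then the event that
`h₀` is at least `K_j T (N₀ + I) / a`, so its conditional probability is a tail of the normalised
gamma law. Alzer's inequality (`Params.alzer`) bounds this tail by `1 - (1 - exp (-K_j T (N₀ + I)))
^ N_h`, strictly if `N_h ≥ 2`; if `N_h = 1` the law is exponential and the bound is exact. Expanding
the power leaves the terms `exp (-n K_j T N₀) * exp (-s I)` with `s = n K_j T`. Since `I` is
independent of the typical link, averaging over `I` needs only its Laplace transform.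

Given the locations, the marks are independent, so the mean of `exp (-s I)` is the mean of the
product over the interferers of `v ‖X i‖`, where `v = powerLaplace s` averages over one mark. The
Laplace functional of the Poisson process (`IsPoissonProcess.integral_expNeg_tsum`) turns this into
`exp (-λ ∫ (1 - v))`, and polar coordinates produce `2π` times the stated exponents
(`laplace_interference`).

For Alzer's inequality, the difference of the two sides vanishes at `0` and at infinity, and its
derivative stays positive once it is nonnegative. A nonnegative value at some `y > 0` would force
the difference to increase strictly from there on, against its limit `0`.

Interference takes values in `[0, ∞]`, with `exp (-∞) = 0`, so limits need no finiteness hypothesis.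
The strict inequality survives integration because `I` is finite with positive probability. -/

noncomputable section

namespace MmWave

open Filter Topology

/-! ### The exponential `exp (-u)` on `[0, ∞]` -/

/-- The function `u ↦ exp (-u)` on `[0, ∞]`, vanishing at infinity. -/
def expNeg (u : ℝ≥0∞) : ℝ := (EReal.exp (-(u : EReal))).toReal

@[simp] lemma expNeg_zero : expNeg 0 = 1 := by simp [expNeg]

@[simp] lemma expNeg_top : expNeg ⊤ = 0 := by simp [expNeg]

lemma expNeg_of_ne_top {u : ℝ≥0∞} (hu : u ≠ ⊤) : expNeg u = Real.exp (-u.toReal) := by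
  lift u to NNReal using hu
  have : ((u : ℝ≥0∞) : EReal) = ((u : ℝ) : EReal) := rfl
  rw [expNeg, this, ← EReal.coe_neg, EReal.exp_coe, ENNReal.toReal_ofReal (Real.exp_pos _).le]
  simp

lemma expNeg_ofReal {x : ℝ} (hx : 0 ≤ x) : expNeg (ENNReal.ofReal x) = Real.exp (-x) := by
  rw [expNeg_of_ne_top ENNReal.ofReal_ne_top, ENNReal.toReal_ofReal hx]

lemma expNeg_nonneg (u : ℝ≥0∞) : 0 ≤ expNeg u := ENNReal.toReal_nonneg

lemma expNeg_le_one (u : ℝ≥0∞) : expNeg u ≤ 1 := by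
  by_cases hu : u = ⊤
  · simp [hu]
  · rw [expNeg_of_ne_top hu]
    exact Real.exp_le_one_iff.2 (neg_nonpos.2 ENNReal.toReal_nonneg)

lemma antitone_expNeg : Antitone expNeg := by
  intro u v huv
  by_cases hv : v = ⊤
  · simp [hv, expNeg_nonneg]
  · rw [expNeg_of_ne_top hv, expNeg_of_ne_top (ne_top_of_le_ne_top hv huv)]
    exact Real.exp_le_exp.2 (neg_le_neg (ENNReal.toReal_mono hv huv))

lemma expNeg_add (u v : ℝ≥0∞) : expNeg (u + v) = expNeg u * expNeg v := by
  by_cases hu : u = ⊤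
  · simp [hu]
  by_cases hv : v = ⊤
  · simp [hv]
  rw [expNeg_of_ne_top hu, expNeg_of_ne_top hv, expNeg_of_ne_top (ENNReal.add_ne_top.2 ⟨hu, hv⟩),
    ENNReal.toReal_add hu hv, neg_add, Real.exp_add]

lemma expNeg_sum {ι : Type*} (s : Finset ι) (u : ι → ℝ≥0∞) :
    expNeg (∑ i ∈ s, u i) = ∏ i ∈ s, expNeg (u i) := by
  classical
  induction s using Finset.induction_on with
  | empty => simp
  | insert i s hi ih => rw [Finset.sum_insert hi, Finset.prod_insert hi, expNeg_add, ih]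

/-- Continuity includes the point `⊤`. Together with the bound by one, it lets dominated convergence
apply to sums that may diverge. -/
lemma continuous_expNeg : Continuous expNeg := by
  have h : Continuous fun u : ℝ≥0∞ => EReal.exp (-(u : EReal)) :=
    ENNReal.continuous_exp.comp (continuous_neg.comp continuous_coe_ennreal_ereal)
  refine continuous_iff_continuousAt.2 fun u => ?_
  refine (ENNReal.tendsto_toReal ?_).comp h.continuousAt
  rw [Ne, EReal.exp_eq_top_iff, EReal.neg_eq_top_iff]
  exact EReal.coe_ennreal_ne_bot u

@[fun_prop] lemma measurable_expNeg : Measurable expNeg := continuous_expNeg.measurable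

lemma integrable_expNeg {Ω : Type*} [MeasurableSpace Ω] (μ : Measure Ω) [IsFiniteMeasure μ]
    {f : Ω → ℝ≥0∞} (hf : Measurable f) : Integrable (fun ω => expNeg (f ω)) μ := by
  refine Integrable.of_bound (measurable_expNeg.comp hf).aestronglyMeasurable 1
    (Eventually.of_forall fun ω => ?_)
  rw [Real.norm_of_nonneg (expNeg_nonneg _)]
  exact expNeg_le_one _

/-- Monotone limits in the exponent may be exchanged with the integral of `exp (-·)`. -/
lemma tendsto_integral_expNeg {Ω : Type*} [MeasurableSpace Ω] (μ : Measure Ω) [IsFiniteMeasure μ]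
    {f : ℕ → Ω → ℝ≥0∞} {g : Ω → ℝ≥0∞} (hf : ∀ n, Measurable (f n))
    (hfg : ∀ ω, Tendsto (fun n => f n ω) atTop (𝓝 (g ω))) :
    Tendsto (fun n => ∫ ω, expNeg (f n ω) ∂μ) atTop (𝓝 (∫ ω, expNeg (g ω) ∂μ)) := by
  refine tendsto_integral_of_dominated_convergence (fun _ => 1) (fun n => ?_)
    (integrable_const _) (fun n => Eventually.of_forall fun ω => ?_)
    (Eventually.of_forall fun ω => ?_)
  · exact (measurable_expNeg.comp (hf n)).aestronglyMeasurable
  · rw [Real.norm_of_nonneg (expNeg_nonneg _)]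
    exact expNeg_le_one _
  · exact (continuous_expNeg.tendsto _).comp (hfg ω)

/-! ### The Laplace functional of a Poisson process -/

lemma tsum_fin_prod_eq_prod_tsum {m : ℕ} (f : Fin m → ℕ → ℝ≥0∞) :
    ∑' k : Fin m → ℕ, ∏ j, f j (k j) = ∏ j, ∑' k, f j k := by
  induction m with
  | zero => simp [tsum_fintype]
  | succ m ih =>
    rw [← (Fin.consEquiv fun _ : Fin (m + 1) => ℕ).tsum_eq,
      ENNReal.tsum_prod (f := fun a k => ∏ j, f j (Fin.consEquiv (fun _ => ℕ) (a, k) j)),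
      Fin.prod_univ_succ, ← ih fun j => f j.succ, ← ENNReal.tsum_mul_right]
    refine tsum_congr fun a => ?_
    rw [← ENNReal.tsum_mul_left]
    refine tsum_congr fun k => ?_
    rw [Fin.prod_univ_succ]
    simp [Fin.consEquiv]

/-- The probability generating function of a Poisson variable, from the exponential series at `c *
t`. At `c = 1` it says that the weights have total mass one. -/
lemma tsum_poisson_mul_pow {t c : ℝ} (ht : 0 ≤ t) (hc : 0 ≤ c) :
    ∑' k : ℕ, ENNReal.ofReal (c ^ k) * ENNReal.ofReal (Real.exp (-t) * t ^ k / k.factorial)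
      = ENNReal.ofReal (Real.exp (-(t * (1 - c)))) := by
  have h : HasSum (fun k : ℕ => Real.exp (-t) * ((c * t) ^ k / k.factorial))
      (Real.exp (-t) * Real.exp (c * t)) := by
    have := NormedSpace.expSeries_div_hasSum_exp (𝔸 := ℝ) (c * t)
    rw [← Real.exp_eq_exp_ℝ] at this
    exact this.mul_left _
  rw [show -(t * (1 - c)) = -t + c * t by ring, Real.exp_add, ← h.tsum_eq,
    ENNReal.ofReal_tsum_of_nonneg (fun k => by positivity) h.summable]
  refine tsum_congr fun k => ?_
  rw [← ENNReal.ofReal_mul (by positivity)]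
  congr 1
  rw [mul_pow]
  ring

section Poisson

variable {Ω : Type*} {X : ℕ → Ω → Plane}

/-- The number of points of the family in a set, as an extended nonnegative real. -/
def count (X : ℕ → Ω → Plane) (B : Set Plane) (ω : Ω) : ℝ≥0∞ :=
  ∑' i, B.indicator 1 (X i ω)

lemma count_eq_encard (B : Set Plane) (ω : Ω) : count X B ω = ({i | X i ω ∈ B}.encard : ℝ≥0∞) := by
  rw [← ENNReal.tsum_set_one, tsum_subtype {i | X i ω ∈ B} (fun _ => (1 : ℝ≥0∞))]
  rfl

lemma count_eq_natCast_iff (B : Set Plane) (ω : Ω) (k : ℕ) :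
    count X B ω = k ↔ {i | X i ω ∈ B}.encard = k := by
  rw [count_eq_encard, ← ENat.toENNReal_coe, ENat.toENNReal_inj]

variable [MeasurableSpace Ω] {μ : Measure Ω} {intensity : ℝ}

lemma measurable_count (hX : ∀ i, Measurable (X i)) {B : Set Plane} (hB : MeasurableSet B) :
    Measurable (count X B) :=
  Measurable.tsum fun i => (measurable_one.indicator hB).comp (hX i)

/-- The Laplace transform of the numbers of points in disjoint bounded sets. -/
lemma IsPoissonProcess.integral_expNeg_sum_count [IsProbabilityMeasure μ] (hl : 0 ≤ intensity)
    (hX : IsPoissonProcess μ intensity X) {m : ℕ} (B : Fin m → Set Plane) (y : Fin m → ℝ≥0∞)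
    (hy : ∀ j, y j ≠ ⊤) (hB : ∀ j, MeasurableSet (B j)) (hb : ∀ j, Bornology.IsBounded (B j))
    (hd : Pairwise fun j j' => Disjoint (B j) (B j')) :
    ∫ ω, expNeg (∑ j, y j * count X (B j) ω) ∂μ
      = Real.exp (-(intensity * ∑ j, volume.real (B j) * (1 - expNeg (y j)))) := by
  set t : Fin m → ℝ := fun j => intensity * volume.real (B j)
  have ht : ∀ j, 0 ≤ t j := fun j => mul_nonneg hl measureReal_nonneg
  set S : (Fin m → ℕ) → Set Ω := fun k => {ω | ∀ j, count X (B j) ω = k j}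
  have hmc := fun j => measurable_count hX.measurable (hB j)
  have hS : ∀ k, MeasurableSet (S k) := fun k => by
    simp only [S, Set.ofPred_forall]
    exact MeasurableSet.iInter fun j => hmc j (measurableSet_singleton _)
  have hSd : Pairwise (Function.onFun Disjoint S) := by
    intro k k' hkk'
    refine Set.disjoint_left.2 fun ω h h' => hkk' (funext fun j => ?_)
    exact_mod_cast (h j).symm.trans (h' j)
  have hμS : ∀ k, μ (S k) = ∏ j, ENNReal.ofReal (Real.exp (-t j) * t j ^ k j / (k j).factorial) :=
    fun k => by
      refine Eq.trans ?_ (hX.counts m B k hB hb hd)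
      simp only [S, count_eq_natCast_iff]
  -- The probabilities of all vectors of finite counts sum to one, so almost surely all counts are
  -- finite. The integral then splits over the events `S k`, on each of which the integrand is
  -- constant.
  have hU : ∀ᵐ ω ∂μ, ω ∈ ⋃ k, S k := by
    refine (mem_ae_iff_prob_eq_one (MeasurableSet.iUnion hS)).2 ?_
    rw [measure_iUnion hSd hS]
    simp only [hμS]
    rw [tsum_fin_prod_eq_prod_tsum
      fun j k => ENNReal.ofReal (Real.exp (-t j) * t j ^ k / k.factorial)]
    refine Finset.prod_eq_one fun j _ => ?_
    simpa using tsum_poisson_mul_pow (ht j) zero_le_one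
  have hm : Measurable fun ω => ∑ j, y j * count X (B j) ω := by fun_prop
  rw [integral_eq_lintegral_of_nonneg_ae (Eventually.of_forall fun _ => expNeg_nonneg _)
    (measurable_expNeg.comp hm).aestronglyMeasurable, ← Measure.restrict_eq_self_of_ae_mem hU,
    lintegral_iUnion hS hSd]
  have hk : ∀ k, ∫⁻ ω in S k, ENNReal.ofReal (expNeg (∑ j, y j * count X (B j) ω)) ∂μ
      = ∏ j, ENNReal.ofReal (expNeg (y j) ^ k j)
        * ENNReal.ofReal (Real.exp (-t j) * t j ^ k j / (k j).factorial) := by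
    intro k
    rw [setLIntegral_congr_fun (g := fun _ => ∏ j, ENNReal.ofReal (expNeg (y j) ^ k j)) (hS k),
      setLIntegral_const, hμS, Finset.prod_mul_distrib]
    intro ω hω
    simp only
    rw [expNeg_sum, ENNReal.ofReal_prod_of_nonneg fun _ _ => expNeg_nonneg _]
    refine Finset.prod_congr rfl fun j _ => ?_
    rw [hω j, expNeg_of_ne_top (hy j), expNeg_of_ne_top (ENNReal.mul_ne_top (hy j) (by simp)),
      ← Real.exp_nat_mul]
    simp [mul_comm]
  simp only [hk]
  rw [tsum_fin_prod_eq_prod_tsum fun j k => ENNReal.ofReal (expNeg (y j) ^ k)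
    * ENNReal.ofReal (Real.exp (-t j) * t j ^ k / k.factorial)]
  simp only [tsum_poisson_mul_pow (ht _) (expNeg_nonneg _)]
  rw [← ENNReal.ofReal_prod_of_nonneg fun _ _ => (Real.exp_pos _).le, ← Real.exp_sum,
    ENNReal.toReal_ofReal (Real.exp_pos _).le, Finset.sum_neg_distrib, Finset.mul_sum]
  simp [t, mul_assoc]

/-- The Laplace functional of a Poisson process at a simple function of bounded support. -/
lemma IsPoissonProcess.integral_expNeg_tsum_simpleFunc [IsProbabilityMeasure μ]
    (hl : 0 ≤ intensity) (hX : IsPoissonProcess μ intensity X) (f : SimpleFunc Plane ℝ≥0∞)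
    (hf : ∀ x, f x ≠ ⊤) (hb : Bornology.IsBounded (Function.support f)) :
    ∫ ω, expNeg (∑' i, f (X i ω)) ∂μ
      = Real.exp (-(intensity * ∫ x, (1 - expNeg (f x)))) := by
  classical
  -- The value `0` is dropped: only the fibres over nonzero values are bounded, as subsets of the
  -- support.
  set s : Finset ℝ≥0∞ := f.range.filter (· ≠ 0)
  set e := s.equivFin
  set y : Fin s.card → ℝ≥0∞ := fun j => (e.symm j : ℝ≥0∞)
  have hys : ∀ j, y j ∈ s := fun j => (e.symm j).2
  have hinj : Function.Injective y := Subtype.val_injective.comp e.symm.injective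
  set B : Fin s.card → Set Plane := fun j => f ⁻¹' {y j}
  have hB : ∀ j, MeasurableSet (B j) := fun j => f.measurableSet_fiber _
  have hbB : ∀ j, Bornology.IsBounded (B j) := fun j => hb.subset fun x hx => by
    have hx : f x = y j := hx
    rw [Function.mem_support, hx]
    exact (Finset.mem_filter.1 (hys j)).2
  have hd : Pairwise fun j j' => Disjoint (B j) (B j') := fun j j' hjj' =>
    Set.disjoint_left.2 fun x h h' => hjj' (hinj (Eq.trans (Eq.symm h) h'))
  have hy : ∀ j, y j ≠ ⊤ := fun j => by
    obtain ⟨x, hx⟩ := SimpleFunc.mem_range.1 (Finset.mem_filter.1 (hys j)).1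
    rw [← hx]
    exact hf x
  -- Used for `F = id`, to write the sum over points through counts, and for `F = 1 - expNeg`, to
  -- compute the integral on the right. Both vanish at `0`.
  have hsum : ∀ (F : ℝ≥0∞ → ℝ≥0∞) x, F 0 = 0 → F (f x) = ∑ j, F (y j) * (B j).indicator 1 x := by
    intro F x hF
    by_cases hx : f x = 0
    · rw [hx, hF, Finset.sum_eq_zero]
      intro j _
      rw [Set.indicator_of_notMem, mul_zero]
      intro h
      have h : f x = y j := h
      exact (Finset.mem_filter.1 (hys j)).2 (h ▸ hx)
    · have hxs : f x ∈ s := Finset.mem_filter.2 ⟨f.mem_range_self x, hx⟩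
      have hyx : y (e ⟨f x, hxs⟩) = f x := by simp [y]
      rw [Finset.sum_eq_single (e ⟨f x, hxs⟩), hyx, Set.indicator_of_mem]
      · simp
      · exact hyx.symm
      · intro j _ hj
        rw [Set.indicator_of_notMem, mul_zero]
        intro h
        exact hj (hinj (Eq.trans (Eq.symm h) hyx.symm))
      · simp
  have hcount : ∀ ω, ∑' i, f (X i ω) = ∑ j, y j * count X (B j) ω := by
    intro ω
    simp only [count, ← ENNReal.tsum_mul_left]
    rw [← Summable.tsum_finsetSum fun _ _ => ENNReal.summable]
    exact tsum_congr fun i => hsum id _ rfl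
  simp only [hcount]
  rw [hX.integral_expNeg_sum_count hl B y hy hB hbB hd]
  have hvol : ∀ j, volume (B j) ≠ ⊤ := fun j => (hbB j).measure_lt_top.ne
  have hint : ∫ x, (1 - expNeg (f x)) = ∑ j, volume.real (B j) * (1 - expNeg (y j)) := by
    have h1 : ∀ x, 1 - expNeg (f x) = ∑ j, (B j).indicator (fun _ => 1 - expNeg (y j)) x := by
      intro x
      have h := hsum (fun u => ENNReal.ofReal (1 - expNeg u)) x (by simp)
      have h2 := congrArg ENNReal.toReal h
      rw [ENNReal.toReal_ofReal (sub_nonneg.2 (expNeg_le_one _)), ENNReal.toReal_sum] at h2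
      · rw [h2]
        refine Finset.sum_congr rfl fun j _ => ?_
        by_cases hx : x ∈ B j <;> simp [hx, expNeg_le_one]
      · intro j _
        by_cases hx : x ∈ B j <;> simp [hx]
    simp only [h1]
    rw [integral_finsetSum]
    · exact Finset.sum_congr rfl fun j _ => by
        rw [integral_indicator_const _ (hB j), smul_eq_mul]
    · intro j _
      exact (integrable_indicator_iff (hB j)).2 (integrableOn_const (hvol j))
  rw [hint]

/-- Monotone convergence for the counting measure. -/
lemma tendsto_tsum_of_monotone {f : ℕ → ℕ → ℝ≥0∞} {g : ℕ → ℝ≥0∞} (hf : ∀ i, Monotone (f i))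
    (hfg : ∀ i, Tendsto (f i) atTop (𝓝 (g i))) :
    Tendsto (fun n => ∑' i, f i n) atTop (𝓝 (∑' i, g i)) := by
  have h := lintegral_tendsto_of_tendsto_of_monotone (μ := Measure.count) (f := fun n i => f i n)
    (F := g) (fun n => (measurable_of_countable _).aemeasurable)
    (Eventually.of_forall hf) (Eventually.of_forall hfg)
  simpa [lintegral_count] using h

/-- The Laplace functional of a Poisson process. -/
theorem IsPoissonProcess.integral_expNeg_tsum [IsProbabilityMeasure μ]
    (hl : 0 ≤ intensity) (hX : IsPoissonProcess μ intensity X) {u : Plane → ℝ≥0∞}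
    (hu : Measurable u) (hint : Integrable fun x => 1 - expNeg (u x)) :
    ∫ ω, expNeg (∑' i, u (X i ω)) ∂μ
      = Real.exp (-(intensity * ∫ x, (1 - expNeg (u x)))) := by
  -- `eapprox` takes only finite values, and the restriction to a ball of radius `n` makes the
  -- support bounded; the sequence still increases to `u`.
  set f : ℕ → SimpleFunc Plane ℝ≥0∞ :=
    fun n => (SimpleFunc.eapprox u n).restrict (Metric.ball 0 n)
  have hf : ∀ n x, f n x = (Metric.ball 0 (n : ℝ)).indicator (SimpleFunc.eapprox u n) x :=
    fun n x => SimpleFunc.restrict_apply _ Metric.isOpen_ball.measurableSet x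
  have hmono : ∀ x, Monotone fun n => f n x := by
    intro x n m hnm
    simp only [hf]
    refine (Set.indicator_le_indicator ((SimpleFunc.monotone_eapprox u hnm) x)).trans ?_
    exact Set.indicator_le_indicator_of_subset
      (Metric.ball_subset_ball (by exact_mod_cast hnm)) (fun _ => zero_le) x
  have hlim : ∀ x, Tendsto (fun n => f n x) atTop (𝓝 (u x)) := by
    intro x
    refine (SimpleFunc.tendsto_eapprox hu x).congr' ?_
    obtain ⟨n₀, hn₀⟩ := exists_nat_gt ‖x‖
    filter_upwards [eventually_ge_atTop n₀] with n hn
    rw [hf, Set.indicator_of_mem]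
    rw [mem_ball_zero_iff]
    exact hn₀.trans_le (by exact_mod_cast hn)
  have hle : ∀ n x, f n x ≤ u x := fun n x => (hmono x).ge_of_tendsto (hlim x) n
  have hsimple : ∀ n, ∫ ω, expNeg (∑' i, f n (X i ω)) ∂μ
      = Real.exp (-(intensity * ∫ x, (1 - expNeg (f n x)))) := by
    intro n
    refine hX.integral_expNeg_tsum_simpleFunc hl (f n) (fun x => ?_) ?_
    · rw [hf]
      refine ne_top_of_le_ne_top (SimpleFunc.eapprox_lt_top u n x).ne ?_
      exact Set.indicator_le_self' (fun _ _ => zero_le) x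
    · refine (Metric.isBounded_ball (x := (0 : Plane)) (r := n)).subset fun x hx => ?_
      by_contra h
      exact hx (by rw [hf, Set.indicator_of_notMem h])
  have hL : Tendsto (fun n => ∫ ω, expNeg (∑' i, f n (X i ω)) ∂μ) atTop
      (𝓝 (∫ ω, expNeg (∑' i, u (X i ω)) ∂μ)) := by
    refine tendsto_integral_expNeg μ (fun n => ?_) fun ω => ?_
    · exact Measurable.tsum fun i => (f n).measurable.comp (hX.measurable i)
    · exact tendsto_tsum_of_monotone (fun i => hmono _) fun i => hlim _
  have hR : Tendsto (fun n => ∫ x, (1 - expNeg (f n x))) atTop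
      (𝓝 (∫ x, (1 - expNeg (u x)))) := by
    refine tendsto_integral_of_dominated_convergence _ (fun n => ?_) hint
      (fun n => Eventually.of_forall fun x => ?_) (Eventually.of_forall fun x => ?_)
    · exact (measurable_const.sub
        (measurable_expNeg.comp (f n).measurable)).aestronglyMeasurable
    · rw [Real.norm_of_nonneg (sub_nonneg.2 (expNeg_le_one _))]
      exact sub_le_sub_left (antitone_expNeg (hle n x)) _
    · exact tendsto_const_nhds.sub ((continuous_expNeg.tendsto _).comp (hlim x))
  refine tendsto_nhds_unique hL ?_
  simp only [hsimple]
  exact (Real.continuous_exp.tendsto _).comp (hR.const_mul intensity).neg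

end Poisson

/-! ### Alzer's inequality -/

/-- If `f 0 ≤ 0` and `f'` stays positive once it is nonnegative, then `f` is strictly increasing
once it is nonnegative. -/
lemma strictMonoOn_of_nonneg_of_deriv {f f' : ℝ → ℝ} (hc : Continuous f)
    (hd : ∀ x, 0 < x → HasDerivAt f (f' x) x) (h0 : f 0 ≤ 0)
    (hf' : ∀ x, 0 < x → 0 ≤ f' x → ∀ y, x < y → 0 < f' y) {x : ℝ} (hx : 0 < x) (hfx : 0 ≤ f x) :
    StrictMonoOn f (Set.Ici x) := by
  -- By the mean value theorem, the rise from `f 0 ≤ 0` to `f x ≥ 0` yields a point of `(0, x)` at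
  -- which the derivative is nonnegative.
  obtain ⟨z, hz, hfz⟩ := exists_hasDerivAt_eq_slope f f' hx hc.continuousOn
    fun y hy => hd y hy.1
  have hz' : 0 ≤ f' z := by
    rw [hfz]
    exact div_nonneg (by linarith) (by linarith)
  refine strictMonoOn_of_deriv_pos (convex_Ici x) hc.continuousOn fun y hy => ?_
  rw [interior_Ici, Set.mem_Ioi] at hy
  rw [(hd y (hx.trans hy)).deriv]
  exact hf' z hz.1 hz' y (hz.2.trans hy)

/-- The conclusion for `f` has the form of the hypothesis on `f'`, so the principle can be iterated
from a derivative up to its successive primitives. -/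
lemma pos_of_nonneg_of_deriv {f f' : ℝ → ℝ} (hc : Continuous f)
    (hd : ∀ x, 0 < x → HasDerivAt f (f' x) x) (h0 : f 0 ≤ 0)
    (hf' : ∀ x, 0 < x → 0 ≤ f' x → ∀ y, x < y → 0 < f' y) (x : ℝ) (hx : 0 < x) (hfx : 0 ≤ f x)
    (y : ℝ) (hxy : x < y) : 0 < f y :=
  hfx.trans_lt (strictMonoOn_of_nonneg_of_deriv hc hd h0 hf' hx hfx Set.self_mem_Ici hxy.le hxy)

lemma hasDerivAt_exp_mul (c x : ℝ) :
    HasDerivAt (fun x => Real.exp (c * x)) (c * Real.exp (c * x)) x := by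
  simpa [mul_comm] using ((hasDerivAt_id x).const_mul c).exp

/-- The function and its derivative both vanish at `0`, so `pos_of_nonneg_of_deriv` applies twice.
The second derivative is `exp ((c - a) x)` times `c² exp (a x) - (c - a)²`; the latter factor is
strictly increasing, so it stays positive once nonnegative. -/
lemma exp_sub_exp_sub_linear_pos {a c : ℝ} (ha : 0 < a) (hc : 0 < c) (x : ℝ) (hx : 0 < x)
    (h : 0 ≤ Real.exp (c * x) - Real.exp ((c - a) * x) - a * x) (y : ℝ) (hxy : x < y) :
    0 < Real.exp (c * y) - Real.exp ((c - a) * y) - a * y := by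
  refine pos_of_nonneg_of_deriv
    (f := fun x => Real.exp (c * x) - Real.exp ((c - a) * x) - a * x)
    (f' := fun x => c * Real.exp (c * x) - (c - a) * Real.exp ((c - a) * x) - a)
    (by fun_prop) (fun x _ => ?_) (by simp) ?_ x hx h y hxy
  · have h1 : HasDerivAt (fun x => a * x) a x := by simpa using (hasDerivAt_id x).const_mul a
    exact ((hasDerivAt_exp_mul c x).sub (hasDerivAt_exp_mul (c - a) x)).sub h1
  refine pos_of_nonneg_of_deriv
    (f' := fun x => c * (c * Real.exp (c * x)) - (c - a) * ((c - a) * Real.exp ((c - a) * x)))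
    (by fun_prop) (fun x _ => ?_) (by simp) ?_
  · exact (((hasDerivAt_exp_mul c x).const_mul c).sub
      ((hasDerivAt_exp_mul (c - a) x).const_mul (c - a))).sub_const a
  intro x _ h y hxy
  have key : ∀ z, c * (c * Real.exp (c * z)) - (c - a) * ((c - a) * Real.exp ((c - a) * z))
      = Real.exp ((c - a) * z) * (c ^ 2 * Real.exp (a * z) - (c - a) ^ 2) := by
    intro z
    rw [show c * z = (c - a) * z + a * z by ring, Real.exp_add]
    ring
  rw [key] at h ⊢
  have h1 := nonneg_of_mul_nonneg_right h (Real.exp_pos _)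
  have h2 : Real.exp (a * x) < Real.exp (a * y) := Real.exp_lt_exp.2 (by gcongr)
  refine mul_pos (Real.exp_pos _) ?_
  nlinarith [pow_pos hc 2]

/-- The gamma distribution function with natural shape, as an integral of the density. -/
lemma cdf_gammaMeasure_natCast {N : ℕ} (hN : 1 ≤ N) {r y : ℝ} (hr : 0 < r) (hy : 0 ≤ y) :
    cdf (gammaMeasure N r) y
      = ∫ t in (0 : ℝ)..y, r ^ N / (N - 1).factorial * t ^ (N - 1) * Real.exp (-(r * t)) := by
  have hN' : (0 : ℝ) < N := by exact_mod_cast hN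
  rw [cdf_gammaMeasure_eq_integral hN' hr, intervalIntegral.integral_of_le hy]
  have h : ∀ᵐ t, gammaPDFReal N r t = (Set.Ioi 0).indicator
      (fun t => r ^ N / (N - 1).factorial * t ^ (N - 1) * Real.exp (-(r * t))) t := by
    filter_upwards [Measure.ae_ne volume 0] with t ht
    have hNN : (N : ℝ) - 1 = ((N - 1 : ℕ) : ℝ) := by push_cast [hN]; ring
    rcases lt_or_gt_of_ne ht with h | h
    · rw [Set.indicator_of_notMem (by simpa using h.le), gammaPDFReal, if_neg (not_le.2 h)]
    · rw [Set.indicator_of_mem (by simpa using h), gammaPDFReal, if_pos h.le, hNN,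
        Real.rpow_natCast, Real.rpow_natCast, ← Real.Gamma_nat_eq_factorial, ← hNN, sub_add_cancel]
  rw [integral_congr_ae (ae_restrict_of_ae h), setIntegral_indicator measurableSet_Ioi,
    Set.inter_comm, Set.Ioi_inter_Iic]

/-- This identity singles out `a`: near `0` the gamma distribution function behaves like `N ^ N y ^
N / N!` and `(1 - exp (-a y)) ^ N` like `(a y) ^ N`, and the two coefficients agree. -/
lemma Params.a_pow_mul_factorial (P : Params) :
    P.a ^ P.Nh * P.Nh.factorial = (P.Nh : ℝ) ^ P.Nh := by
  have hN : (P.Nh : ℝ) ≠ 0 := by exact_mod_cast Nat.one_le_iff_ne_zero.1 P.Nh_pos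
  have hf : (0 : ℝ) < P.Nh.factorial := by exact_mod_cast P.Nh.factorial_pos
  rw [Params.a, mul_pow, ← Real.rpow_natCast (_ ^ (-1 / (P.Nh : ℝ))), ← Real.rpow_mul hf.le,
    div_mul_cancel₀ _ hN, Real.rpow_neg_one, mul_assoc, inv_mul_cancel₀ hf.ne', mul_one]

lemma Params.a_pos (P : Params) : 0 < P.a := by
  have hN : (0 : ℝ) < P.Nh := by exact_mod_cast P.Nh_pos
  have hf : (0 : ℝ) < P.Nh.factorial := by exact_mod_cast P.Nh.factorial_pos
  unfold Params.a
  positivity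

lemma Params.a_lt (P : Params) (h2 : 2 ≤ P.Nh) : P.a < P.Nh := by
  have hN : (0 : ℝ) < P.Nh := by exact_mod_cast P.Nh_pos
  have hf : (1 : ℝ) < P.Nh.factorial := by exact_mod_cast Nat.one_lt_factorial.2 h2
  rw [Params.a]
  refine mul_lt_of_lt_one_right hN (Real.rpow_lt_one_of_one_lt_of_neg hf ?_)
  exact div_neg_of_neg_of_pos (by norm_num) hN

lemma Params.a_eq_one (P : Params) (h1 : P.Nh = 1) : P.a = 1 := by
  simp [Params.a, h1]

/-- Alzer's inequality for the distribution function of a normalised gamma variable. -/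
theorem Params.alzer (P : Params) (h2 : 2 ≤ P.Nh) {y : ℝ} (hy : 0 < y) :
    (1 - Real.exp (-(P.a * y))) ^ P.Nh < cdf P.fadingLaw y := by
  obtain ⟨M, hM⟩ : ∃ M, P.Nh = M + 1 := ⟨P.Nh - 1, by omega⟩
  have hM1 : (0 : ℝ) < M := by exact_mod_cast (by omega : 0 < M)
  have hN : (0 : ℝ) < P.Nh := by exact_mod_cast P.Nh_pos
  set a := P.a
  have ha : 0 < a := P.a_pos
  -- Chosen so that `exp (-N x) = exp (-a x) * exp (-c x) ^ M`. The derivative of the difference `f`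
  -- is then a positive factor times a difference of two `M`-th powers, whose sign is that of the
  -- difference of the bases.
  set c : ℝ := (P.Nh - a) / M
  have hc : 0 < c := div_pos (sub_pos.2 (P.a_lt h2)) hM1
  set g : ℝ → ℝ := fun t =>
    (P.Nh : ℝ) ^ P.Nh / (P.Nh - 1).factorial * t ^ (P.Nh - 1) * Real.exp (-(P.Nh * t))
  have hg : Continuous g := by fun_prop
  set f : ℝ → ℝ := fun x => (1 - Real.exp (-(a * x))) ^ P.Nh - ∫ t in (0 : ℝ)..x, g t
  set f' : ℝ → ℝ := fun x =>
    P.Nh * (1 - Real.exp (-(a * x))) ^ (P.Nh - 1) * (a * Real.exp (-(a * x))) - g x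
  have hd : ∀ x, HasDerivAt f (f' x) x := by
    intro x
    have h1 : HasDerivAt (fun x => Real.exp (-(a * x))) (-a * Real.exp (-(a * x))) x := by
      simpa using hasDerivAt_exp_mul (-a) x
    refine HasDerivAt.sub ?_ (hg.integral_hasStrictDerivAt 0 x).hasDerivAt
    have h2 := (h1.const_sub 1).pow P.Nh
    rw [neg_mul, neg_neg] at h2
    exact h2
  have hcont : Continuous f := continuous_iff_continuousAt.2 fun x => (hd x).continuousAt
  have hcoef : (P.Nh : ℝ) ^ P.Nh / (P.Nh - 1).factorial = P.Nh * a ^ P.Nh := by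
    have h := P.a_pow_mul_factorial
    have hf : ((P.Nh - 1).factorial : ℝ) ≠ 0 := by exact_mod_cast Nat.factorial_ne_zero _
    have hfac : (P.Nh.factorial : ℝ) = P.Nh * (P.Nh - 1).factorial := by
      exact_mod_cast (Nat.mul_factorial_pred (by omega)).symm
    rw [div_eq_iff hf, ← h, hfac]
    ring
  have hf'eq : ∀ x, f' x = P.Nh * a * Real.exp (-(a * x))
      * ((1 - Real.exp (-(a * x))) ^ M - (a * x * Real.exp (-(c * x))) ^ M) := by
    intro x
    have he : Real.exp (-(P.Nh * x)) = Real.exp (-(a * x)) * Real.exp (-(c * x)) ^ M := by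
      rw [← Real.exp_nat_mul, ← Real.exp_add]
      congr 1
      simp only [c]
      field_simp
      ring
    simp only [f', g]
    rw [hcoef, he, show P.Nh - 1 = M by omega, show a ^ P.Nh = a ^ M * a by rw [hM, pow_succ]]
    ring
  -- The difference of the bases is a positive multiple of the function treated in
  -- `exp_sub_exp_sub_linear_pos`.
  have hk : ∀ x, 1 - Real.exp (-(a * x)) - a * x * Real.exp (-(c * x))
      = Real.exp (-(c * x)) * (Real.exp (c * x) - Real.exp ((c - a) * x) - a * x) := by
    intro x
    have h1 : Real.exp (-(c * x)) * Real.exp (c * x) = 1 := by rw [← Real.exp_add]; simp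
    have h2 : Real.exp (-(c * x)) * Real.exp ((c - a) * x) = Real.exp (-(a * x)) := by
      rw [← Real.exp_add]; congr 1; ring
    rw [mul_sub, mul_sub, h1, h2]
    ring
  have hsign : ∀ x, 0 < x → 0 ≤ f' x → ∀ z, x < z → 0 < f' z := by
    intro x hx h z hxz
    have hz := hx.trans hxz
    have hpos : ∀ x, 0 < P.Nh * a * Real.exp (-(a * x)) := fun x => by positivity
    rw [hf'eq] at h ⊢
    have h1 := sub_nonneg.1 (nonneg_of_mul_nonneg_right h (hpos x))
    have h0 : 0 ≤ 1 - Real.exp (-(a * x)) := by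
      rw [sub_nonneg, Real.exp_le_one_iff, neg_nonpos]; positivity
    have h2 := le_of_pow_le_pow_left₀ (by omega) h0 h1
    have h3 := (hk x).symm.trans_ge (sub_nonneg.2 h2)
    have h4 := exp_sub_exp_sub_linear_pos ha hc x hx
      (nonneg_of_mul_nonneg_right h3 (Real.exp_pos _)) z hxz
    have h5 : 0 < 1 - Real.exp (-(a * z)) - a * z * Real.exp (-(c * z)) := by
      rw [hk]
      exact mul_pos (Real.exp_pos _) h4
    refine mul_pos (hpos z) (sub_pos.2 (pow_lt_pow_left₀ (sub_pos.1 h5) (by positivity) ?_))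
    omega
  have hcdf : ∀ x, 0 ≤ x → ∫ t in (0 : ℝ)..x, g t = cdf P.fadingLaw x := fun x hx =>
    (cdf_gammaMeasure_natCast P.Nh_pos hN hx).symm
  by_contra! hcon
  have hfy : 0 ≤ f y := by
    simp only [f]
    rw [hcdf y hy.le]
    linarith
  have hmono := strictMonoOn_of_nonneg_of_deriv hcont (fun x _ => hd x)
    (by simp [f, show P.Nh ≠ 0 by omega]) hsign hy hfy
  have hlim : Tendsto f atTop (𝓝 0) := by
    have h1 : Tendsto (fun x => (1 - Real.exp (-(a * x))) ^ P.Nh) atTop (𝓝 ((1 - 0) ^ P.Nh)) := by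
      refine (tendsto_const_nhds.sub ?_).pow _
      exact Real.tendsto_exp_neg_atTop_nhds_zero.comp (tendsto_id.const_mul_atTop ha)
    have h2 := h1.sub (tendsto_cdf_atTop P.fadingLaw)
    rw [sub_zero, one_pow, sub_self] at h2
    refine h2.congr' ?_
    filter_upwards [eventually_ge_atTop 0] with x hx
    simp only [f]
    rw [hcdf x hx]
  -- Strict growth beyond `y` and the limit `0` at infinity give `0 ≤ f y < f (y + 1) ≤ 0`.
  have h1 : f y < f (y + 1) := hmono Set.self_mem_Ici (by simp) (by linarith)
  have h2 : f (y + 1) ≤ 0 := by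
    refine ge_of_tendsto hlim ?_
    filter_upwards [eventually_ge_atTop (y + 1)] with x hx
    exact hmono.monotoneOn (by simp) (Set.mem_Ici.2 (by linarith)) hx
  linarith

/-! ### Tails and Laplace transform of the fading law -/

instance (P : Params) : IsProbabilityMeasure P.fadingLaw :=
  isProbabilityMeasure_gammaMeasure (by exact_mod_cast P.Nh_pos) (by exact_mod_cast P.Nh_pos)

/-- The law has a density, so the endpoint `y` carries no mass. -/
lemma Params.fadingLaw_real_Ici (P : Params) (y : ℝ) :
    P.fadingLaw.real (Set.Ici y) = 1 - cdf P.fadingLaw y := by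
  have h : P.fadingLaw.real (Set.Iic y) = P.fadingLaw.real (Set.Iio y) := by
    refine measureReal_congr (Iio_ae_eq_Iic' ?_).symm
    exact withDensity_absolutelyContinuous _ _ Real.volume_singleton
  rw [cdf_eq_real, h, ← Set.compl_Iio, probReal_compl_eq_one_sub measurableSet_Iio]

lemma Params.fadingLaw_real_Ici_lt (P : Params) (h2 : 2 ≤ P.Nh) {y : ℝ} (hy : 0 < y) :
    P.fadingLaw.real (Set.Ici y) < 1 - (1 - Real.exp (-(P.a * y))) ^ P.Nh := by
  rw [P.fadingLaw_real_Ici]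
  linarith [P.alzer h2 hy]

lemma Params.fadingLaw_real_Ici_eq (P : Params) (h1 : P.Nh = 1) {y : ℝ} (hy : 0 < y) :
    P.fadingLaw.real (Set.Ici y) = 1 - (1 - Real.exp (-(P.a * y))) ^ P.Nh := by
  have h : P.fadingLaw = expMeasure 1 := by simp [Params.fadingLaw, h1, expMeasure]
  rw [P.fadingLaw_real_Ici, h, cdf_expMeasure_eq one_pos, if_pos hy.le, P.a_eq_one h1, h1]
  simp

lemma measurable_gammaPDF (a r : ℝ) : Measurable (gammaPDF a r) :=
  (measurable_gammaPDFReal a r).ennreal_ofReal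

lemma ae_nonneg_gammaMeasure (a r : ℝ) : ∀ᵐ h ∂gammaMeasure a r, 0 ≤ h := by
  rw [gammaMeasure, ae_withDensity_iff (measurable_gammaPDF a r)]
  refine Eventually.of_forall fun h hh => ?_
  by_contra! hneg
  exact hh (gammaPDF_of_neg hneg)

/-- The Laplace transform of the gamma distribution. -/
lemma integral_exp_neg_mul_gammaMeasure {a r t : ℝ} (ha : 0 < a) (hr : 0 < r) (ht : 0 ≤ t) :
    ∫ h, Real.exp (-(t * h)) ∂gammaMeasure a r = (r / (r + t)) ^ a := by
  have hrt : 0 < r + t := by linarith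
  rw [gammaMeasure, integral_withDensity_eq_integral_toReal_smul
    (measurable_gammaPDF a r) (Eventually.of_forall fun _ => by
      simp [gammaPDF])]
  -- The exponential factor merely shifts the rate from `r` to `r + t`, leaving a gamma integral.
  have h : ∀ x, (gammaPDF a r x).toReal • Real.exp (-(t * x)) = (Set.Ici 0).indicator
      (fun x => r ^ a / Real.Gamma a * (x ^ (a - 1) * Real.exp (-((r + t) * x)))) x := by
    intro x
    rw [gammaPDF, ENNReal.toReal_ofReal (gammaPDFReal_nonneg ha hr x), gammaPDFReal]
    by_cases hx : 0 ≤ x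
    · rw [if_pos hx, Set.indicator_of_mem (Set.mem_Ici.2 hx), smul_eq_mul, add_mul, neg_add,
        Real.exp_add]
      ring
    · rw [if_neg hx, Set.indicator_of_notMem (by simpa using hx), zero_smul]
  simp only [h]
  rw [integral_indicator measurableSet_Ici, integral_Ici_eq_integral_Ioi, integral_const_mul,
    Real.integral_rpow_mul_exp_neg_mul_Ioi ha hrt, Real.div_rpow hr.le hrt.le,
    Real.div_rpow zero_le_one hrt.le, Real.one_rpow]
  have := (Real.Gamma_pos_of_pos ha).ne'
  field_simp

/-! ### Measures on finite products -/

/-- **Tonelli's theorem** for a product of functions of the separate coordinates. -/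
lemma lintegral_fin_prod_eq_prod {β : Type*} [MeasurableSpace β] (ν : Measure β) [SigmaFinite ν]
    {m : ℕ} {f : Fin m → β → ℝ≥0∞} (hf : ∀ i, Measurable (f i)) :
    ∫⁻ x, ∏ i, f i (x i) ∂Measure.pi (fun _ : Fin m => ν) = ∏ i, ∫⁻ b, f i b ∂ν := by
  induction m with
  | zero => simp
  | succ m ih =>
    have hm : Measurable fun x : Fin (m + 1) → β => ∏ i, f i (x i) :=
      Finset.measurable_fun_prod _ fun i _ => (hf i).comp (measurable_pi_apply i)
    rw [← ((measurePreserving_piFinSuccAbove (fun _ : Fin (m + 1) => ν) 0).symm).lintegral_comp hm,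
      Fin.prod_univ_succ, ← ih fun i => hf i.succ,
      ← lintegral_prod_mul (hf 0).aemeasurable (Finset.measurable_fun_prod _ fun i _ =>
        (hf i.succ).comp (measurable_pi_apply i)).aemeasurable]
    refine lintegral_congr fun x => ?_
    simp [MeasurableEquiv.piFinSuccAbove_symm_apply, Fin.insertNthEquiv, Fin.prod_univ_succ]

/-- Finite measures on `α × β ^ m` are determined by their values on boxes. -/
lemma ext_of_prod_pi {α β : Type*} [MeasurableSpace α] [MeasurableSpace β] {m : ℕ}
    {ρ₁ ρ₂ : Measure (α × (Fin m → β))} [IsFiniteMeasure ρ₁]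
    (h : ∀ (B : Set α) (E : Fin m → Set β), MeasurableSet B → (∀ i, MeasurableSet (E i)) →
      ρ₁ (B ×ˢ Set.univ.pi E) = ρ₂ (B ×ˢ Set.univ.pi E)) : ρ₁ = ρ₂ := by
  refine ext_of_generate_finite (Set.image2 (· ×ˢ ·) {s : Set α | MeasurableSet s}
    (Set.univ.pi '' Set.univ.pi fun _ : Fin m => {s : Set β | MeasurableSet s})) ?_
    (MeasurableSpace.isPiSystem_measurableSet.prod isPiSystem_pi) ?_ ?_
  · exact (generateFrom_eq_prod MeasurableSpace.generateFrom_measurableSet generateFrom_pi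
      isCountablySpanning_measurableSet
      (IsCountablySpanning.pi fun _ => isCountablySpanning_measurableSet)).symm
  · rintro _ ⟨B, hB, _, ⟨E, hE, rfl⟩, rfl⟩
    exact h B E hB fun i => hE i trivial
  · simpa using h Set.univ (fun _ => Set.univ) MeasurableSet.univ fun _ => MeasurableSet.univ

/-! ### Laws of the marks -/

namespace Params

variable (P : Params)

lemma losProb_pos (x : ℝ) : 0 < P.losProb x := Real.exp_pos _

lemma losProb_le_one {x : ℝ} (hx : 0 ≤ x) : P.losProb x ≤ 1 := by
  rw [losProb, Real.exp_le_one_iff]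
  nlinarith [P.β_pos]

lemma stateProb_nonneg (b : Bool) {x : ℝ} (hx : 0 ≤ x) : 0 ≤ P.stateProb b x := by
  cases b
  · simpa [stateProb] using P.losProb_le_one hx
  · simpa [stateProb] using (P.losProb_pos x).le

lemma stateProb_le_one (b : Bool) {x : ℝ} (hx : 0 ≤ x) : P.stateProb b x ≤ 1 := by
  cases b
  · simpa [stateProb] using (P.losProb_pos x).le
  · simpa [stateProb] using P.losProb_le_one hx

lemma sum_stateProb (x : ℝ) : ∑ b, P.stateProb b x = 1 := by
  simp [stateProb]

lemma continuous_stateProb (b : Bool) : Continuous (P.stateProb b) := by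
  have h : Continuous P.losProb := by unfold losProb; fun_prop
  cases b
  · exact continuous_const.sub h
  · exact h

lemma gainProb_nonneg (i : Lobes) : 0 ≤ P.gainProb i := by
  have h1 := P.θ_nonneg
  have h2 := sub_nonneg.2 P.θ_le
  have := Real.pi_pos
  cases i <;> simp only [gainProb] <;> positivity

lemma sum_gainProb : ∑ i, P.gainProb i = 1 := by
  have h : (Finset.univ : Finset Lobes) = {.GG, .Gg, .gg} := rfl
  have := Real.pi_pos.ne'
  rw [h, Finset.sum_insert (by decide), Finset.sum_insert (by decide), Finset.sum_singleton]
  simp only [gainProb]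
  field_simp
  ring

instance isFiniteMeasure_stateLaw (x : ℝ) : IsFiniteMeasure (P.stateLaw x) := by
  refine ⟨?_⟩
  simp [stateLaw]

instance isFiniteMeasure_lobesLaw : IsFiniteMeasure P.lobesLaw := by
  refine ⟨?_⟩
  simp [lobesLaw]

lemma lintegral_stateLaw (x : ℝ) (f : Bool → ℝ≥0∞) :
    ∫⁻ b, f b ∂P.stateLaw x = ∑ b, ENNReal.ofReal (P.stateProb b x) * f b := by
  simp [stateLaw, lintegral_smul_measure]

lemma integral_stateLaw {x : ℝ} (hx : 0 ≤ x) (f : Bool → ℝ) :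
    ∫ b, f b ∂P.stateLaw x = ∑ b, P.stateProb b x * f b := by
  rw [stateLaw, integral_finsetSum_measure fun b _ =>
    Integrable.of_finite.smul_measure ENNReal.ofReal_ne_top]
  refine Finset.sum_congr rfl fun b _ => ?_
  rw [integral_smul_measure, integral_dirac, ENNReal.toReal_ofReal (P.stateProb_nonneg b hx),
    smul_eq_mul]

lemma integral_lobesLaw (f : Lobes → ℝ) :
    ∫ i, f i ∂P.lobesLaw = ∑ i, P.gainProb i * f i := by
  rw [lobesLaw, integral_finsetSum_measure fun b _ =>
    Integrable.of_finite.smul_measure ENNReal.ofReal_ne_top]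
  refine Finset.sum_congr rfl fun b _ => ?_
  rw [integral_smul_measure, integral_dirac, ENNReal.toReal_ofReal (P.gainProb_nonneg b),
    smul_eq_mul]

/-- A measure dominating the laws of the marks at all locations. -/
def baseLaw : Measure Mark := (Measure.count : Measure Bool).prod (P.lobesLaw.prod P.fadingLaw)

instance : IsFiniteMeasure P.baseLaw := by
  unfold baseLaw
  infer_instance

/-- The density of the law of the mark at `x` with respect to `baseLaw`. -/
def markDensity (x : Plane) (a : Mark) : ℝ≥0∞ := ENNReal.ofReal (P.stateProb a.1 ‖x‖)

lemma measurable_markDensity : Measurable fun p : Plane × Mark => P.markDensity p.1 p.2 := by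
  have h : Measurable fun p : Bool × ℝ => P.stateProb p.1 p.2 :=
    measurable_from_prod_countable_right fun b => (P.continuous_stateProb b).measurable
  exact (h.comp (by fun_prop : Measurable fun p : Plane × Mark => (p.2.1, ‖p.1‖))).ennreal_ofReal

/-- Only the blockage state depends on the location, so a density over `Bool` suffices. With one
reference measure for all locations, the joint law of locations and marks has a density with respect
to a product measure and Tonelli's theorem applies. -/
lemma markLaw_eq_withDensity (x : Plane) :
    P.markLaw x = P.baseLaw.withDensity (P.markDensity x) := by
  have h : P.stateLaw ‖x‖
      = (Measure.count : Measure Bool).withDensity fun b => ENNReal.ofReal (P.stateProb b ‖x‖) := by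
    refine Measure.ext_of_lintegral _ fun f _ => ?_
    rw [lintegral_stateLaw, lintegral_withDensity_eq_lintegral_mul _ (measurable_of_countable _)
      (measurable_of_countable _), lintegral_count, tsum_fintype]
    rfl
  rw [markLaw, h, prod_withDensity_left (measurable_of_countable _)]
  rfl

lemma lintegral_markLaw (x : Plane) {f : Mark → ℝ≥0∞} (hf : Measurable f) :
    ∫⁻ a, f a ∂P.markLaw x = ∫⁻ a, P.markDensity x a * f a ∂P.baseLaw := by
  have h : Measurable (P.markDensity x) := P.measurable_markDensity.comp measurable_prodMk_left
  rw [markLaw_eq_withDensity, lintegral_withDensity_eq_lintegral_mul _ h hf]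
  rfl

lemma markLaw_apply (x : Plane) {E : Set Mark} (hE : MeasurableSet E) :
    P.markLaw x E = ∫⁻ a, P.markDensity x a * E.indicator 1 a ∂P.baseLaw := by
  rw [← lintegral_markLaw _ _ (measurable_one.indicator hE), lintegral_indicator_one hE]

end Params

/-! ### Joint law of locations and marks, and independence of the typical link -/

namespace Network

variable {P : Params} {Ω : Type*} [MeasurableSpace Ω] {μ : Measure Ω} (N : Network P μ)

/-- The mark of an interferer. -/
def mark (i : ℕ) (ω : Ω) : Mark := (N.los i ω, N.lobes i ω, N.h i ω)

/-- The state of the typical link. -/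
def typical (ω : Ω) : Bool × ℝ := (N.los₀ ω, N.h₀ ω)

/-- All locations and the first `m` marks. -/
def locationsMarks (m : ℕ) (ω : Ω) : (ℕ → Plane) × (Fin m → Mark) :=
  (fun i => N.X i ω, fun i => N.mark i ω)

@[fun_prop] lemma measurable_X (i : ℕ) : Measurable (N.X i) := N.poisson.measurable i

@[fun_prop] lemma measurable_mark (i : ℕ) : Measurable (N.mark i) :=
  (N.measurable_los i).prodMk ((N.measurable_lobes i).prodMk (N.measurable_h i))

@[fun_prop] lemma measurable_typical : Measurable N.typical :=
  N.measurable_los₀.prodMk N.measurable_h₀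

lemma measurable_locations : Measurable fun ω i => N.X i ω :=
  measurable_pi_lambda _ N.measurable_X

@[fun_prop] lemma measurable_locationsMarks (m : ℕ) : Measurable (N.locationsMarks m) :=
  N.measurable_locations.prodMk (measurable_pi_lambda _ fun i => N.measurable_mark i)

lemma measure_box_inter (m : ℕ) {B : Set (ℕ → Plane)} {E : Fin m → Set Mark} {D : Set (Bool × ℝ)}
    (hB : MeasurableSet B) (hE : ∀ i, MeasurableSet (E i)) (hD : MeasurableSet D) :
    μ (N.locationsMarks m ⁻¹' (B ×ˢ Set.univ.pi E) ∩ N.typical ⁻¹' D)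
      = (∫⁻ ω in {ω | (fun i => N.X i ω) ∈ B}, ∏ i : Fin m, P.markLaw (N.X i ω) (E i) ∂μ)
        * P.typicalLaw D := by
  -- The family in `law` is indexed by all of `ℕ`; the sets beyond the first `m` impose no
  -- condition.
  set E' : ℕ → Set Mark := fun i => if h : i < m then E ⟨i, h⟩ else Set.univ
  have hE' : ∀ i : Fin m, E' i = E i := fun i => by simp [E']
  have h := N.law (Finset.range m) B E' D hB (fun i => by
    by_cases h : i < m
    · simpa [E', h] using hE _
    · simp [E', h]) hD
  simp only [Finset.prod_range, hE'] at h
  rw [← h]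
  congr 1
  ext ω
  simp only [Set.mem_inter_iff, Set.mem_preimage, Set.mem_prod, Set.mem_univ_pi, locationsMarks,
    Set.mem_ofPred_eq, Finset.mem_range, typical, mark, and_assoc]
  refine and_congr_right fun _ => and_congr_left fun _ => ⟨fun h i hi => ?_, fun h i => ?_⟩
  · simpa [E', hi] using h ⟨i, hi⟩
  · simpa [E'] using h i i.2

variable [IsProbabilityMeasure μ]

lemma measure_typical {D : Set (Bool × ℝ)} (hD : MeasurableSet D) :
    μ (N.typical ⁻¹' D) = P.typicalLaw D := by
  have h := N.measure_box_inter 0 (E := fun _ => Set.univ) MeasurableSet.univ (by simp) hD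
  simpa using h

lemma map_typical : μ.map N.typical = P.typicalLaw :=
  Measure.ext fun D hD => by rw [Measure.map_apply N.measurable_typical hD, N.measure_typical hD]

lemma measure_box (m : ℕ) {B : Set (ℕ → Plane)} {E : Fin m → Set Mark}
    (hB : MeasurableSet B) (hE : ∀ i, MeasurableSet (E i)) :
    μ (N.locationsMarks m ⁻¹' (B ×ˢ Set.univ.pi E))
      = ∫⁻ ω in {ω | (fun i => N.X i ω) ∈ B}, ∏ i : Fin m, P.markLaw (N.X i ω) (E i) ∂μ := by
  have h := N.measure_box_inter m hB hE MeasurableSet.univ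
  rw [← N.measure_typical MeasurableSet.univ] at h
  simpa using h

lemma indepFun_locationsMarks (m : ℕ) : IndepFun (N.locationsMarks m) N.typical μ := by
  rw [indepFun_iff_measure_inter_preimage_eq_mul]
  intro S D hS hD
  have hm := N.measurable_locationsMarks m
  -- For fixed `D`, both sides are measures in the event about locations and marks. They agree on
  -- boxes by `law`, hence everywhere.
  have key : (μ.restrict (N.typical ⁻¹' D)).map (N.locationsMarks m)
      = μ (N.typical ⁻¹' D) • μ.map (N.locationsMarks m) := by
    refine ext_of_prod_pi fun B E hB hE => ?_
    have hBE : MeasurableSet (B ×ˢ Set.univ.pi E) := hB.prod (MeasurableSet.univ_pi hE)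
    rw [Measure.map_apply hm hBE, Measure.restrict_apply (hm hBE), Measure.smul_apply,
      Measure.map_apply hm hBE, N.measure_box_inter m hB hE hD, N.measure_box m hB hE,
      N.measure_typical hD, smul_eq_mul, mul_comm]
  have h := congrArg (fun ρ => ρ S) key
  simp only [Measure.smul_apply, smul_eq_mul] at h
  rw [Measure.map_apply hm hS, Measure.restrict_apply (hm hS), Measure.map_apply hm hS] at h
  rw [h, mul_comm]

/-- It suffices to compare boxes, where Tonelli's theorem factors the integral over the marks and
each factor is `markLaw` of the corresponding set. -/
lemma map_locationsMarks (m : ℕ) : μ.map (N.locationsMarks m)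
    = ((μ.map fun ω i => N.X i ω).prod (Measure.pi fun _ : Fin m => P.baseLaw)).withDensity
        fun p => ∏ i : Fin m, P.markDensity (p.1 i) (p.2 i) := by
  have hw : ∀ i : Fin m, Measurable fun p : (ℕ → Plane) × (Fin m → Mark) =>
      P.markDensity (p.1 i) (p.2 i) := fun i =>
    P.measurable_markDensity.comp
      (by fun_prop : Measurable fun p : (ℕ → Plane) × (Fin m → Mark) => (p.1 i, p.2 i))
  refine ext_of_prod_pi fun B E hB hE => ?_
  have hBE : MeasurableSet (B ×ˢ Set.univ.pi E) := hB.prod (MeasurableSet.univ_pi hE)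
  have hind : ∀ i : Fin m, Measurable fun a : Fin m → Mark =>
      (E i).indicator (1 : Mark → ℝ≥0∞) (a i) :=
    fun i => (measurable_one.indicator (hE i)).comp (measurable_pi_apply i)
  have hprod : ∀ p : (ℕ → Plane) × (Fin m → Mark), (B ×ˢ Set.univ.pi E).indicator
      (fun p => ∏ i : Fin m, P.markDensity (p.1 i) (p.2 i)) p
      = B.indicator 1 p.1
        * ∏ i : Fin m, (P.markDensity (p.1 i) (p.2 i) * (E i).indicator 1 (p.2 i)) := by
    intro p
    by_cases hp : p ∈ B ×ˢ Set.univ.pi E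
    · rw [Set.indicator_of_mem hp, Set.indicator_of_mem hp.1, Pi.one_apply, one_mul]
      refine Finset.prod_congr rfl fun i _ => ?_
      rw [Set.indicator_of_mem (hp.2 i trivial), Pi.one_apply, mul_one]
    · rw [Set.indicator_of_notMem hp]
      symm
      by_cases hp1 : p.1 ∈ B
      · have : ∃ i, p.2 i ∉ E i := by
          by_contra! hcon
          exact hp ⟨hp1, fun i _ => hcon i⟩
        obtain ⟨i, hi⟩ := this
        rw [Finset.prod_eq_zero (Finset.mem_univ i), mul_zero]
        rw [Set.indicator_of_notMem hi, mul_zero]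
      · rw [Set.indicator_of_notMem hp1, zero_mul]
  have hm1 : Measurable fun p : (ℕ → Plane) × (Fin m → Mark) => (B.indicator 1 p.1 : ℝ≥0∞)
      * ∏ i : Fin m, (P.markDensity (p.1 i) (p.2 i) * (E i).indicator 1 (p.2 i)) :=
    ((measurable_one.indicator hB).comp measurable_fst).mul
      (Finset.measurable_fun_prod _ fun i _ => (hw i).mul ((hind i).comp measurable_snd))
  rw [Measure.map_apply (N.measurable_locationsMarks m) hBE, N.measure_box m hB hE,
    withDensity_apply _ hBE, ← lintegral_indicator hBE]
  simp only [hprod]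
  rw [lintegral_prod _ hm1.aemeasurable,
    lintegral_map hm1.lintegral_prod_right' N.measurable_locations,
    ← lintegral_indicator (show MeasurableSet {ω | (fun i => N.X i ω) ∈ B} from
      N.measurable_locations hB)]
  refine lintegral_congr fun ω => ?_
  have hw' : ∀ x : Plane, Measurable (P.markDensity x) := fun x =>
    P.measurable_markDensity.comp measurable_prodMk_left
  have hm2 : Measurable fun a : Fin m → Mark =>
      ∏ i : Fin m, (P.markDensity (N.X i ω) (a i) * (E i).indicator 1 (a i)) :=
    Finset.measurable_fun_prod _ fun i _ => ((hw' _).comp (measurable_pi_apply i)).mul (hind i)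
  dsimp only
  rw [lintegral_const_mul _ hm2,
    lintegral_fin_prod_eq_prod P.baseLaw (f := fun i a =>
      P.markDensity (N.X i ω) a * (E i).indicator 1 a)
      fun i => (hw' _).mul (measurable_one.indicator (hE i))]
  simp only [← P.markLaw_apply _ (hE _)]
  by_cases hω : (fun i => N.X i ω) ∈ B
  · rw [Set.indicator_of_mem (by exact hω), Set.indicator_of_mem hω, Pi.one_apply, one_mul]
  · rw [Set.indicator_of_notMem (by exact hω), Set.indicator_of_notMem hω, zero_mul]

/-- Conditionally on the locations, the marks are independent with law `markLaw`. -/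
lemma lintegral_prod_mark {φ : Plane → Mark → ℝ≥0∞} (hφ : Measurable (Function.uncurry φ))
    (m : ℕ) :
    ∫⁻ ω, ∏ i ∈ Finset.range m, φ (N.X i ω) (N.mark i ω) ∂μ
      = ∫⁻ ω, ∏ i ∈ Finset.range m, ∫⁻ a, φ (N.X i ω) a ∂P.markLaw (N.X i ω) ∂μ := by
  have hw : ∀ i : Fin m, Measurable fun p : (ℕ → Plane) × (Fin m → Mark) =>
      P.markDensity (p.1 i) (p.2 i) := fun i =>
    P.measurable_markDensity.comp
      (by fun_prop : Measurable fun p : (ℕ → Plane) × (Fin m → Mark) => (p.1 i, p.2 i))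
  have hφ' : ∀ i : Fin m, Measurable fun p : (ℕ → Plane) × (Fin m → Mark) =>
      φ (p.1 i) (p.2 i) := fun i =>
    hφ.comp (by fun_prop : Measurable fun p : (ℕ → Plane) × (Fin m → Mark) => (p.1 i, p.2 i))
  have hw' : ∀ x : Plane, Measurable (P.markDensity x) := fun x =>
    P.measurable_markDensity.comp measurable_prodMk_left
  have hφ_meas : ∀ x : Plane, Measurable (φ x) := fun x => hφ.comp measurable_prodMk_left
  have hm1 : Measurable fun p : (ℕ → Plane) × (Fin m → Mark) => ∏ i : Fin m, φ (p.1 i) (p.2 i) :=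
    Finset.measurable_fun_prod _ fun i _ => hφ' i
  have hm2 : Measurable fun p : (ℕ → Plane) × (Fin m → Mark) =>
      ∏ i : Fin m, P.markDensity (p.1 i) (p.2 i) :=
    Finset.measurable_fun_prod _ fun i _ => hw i
  simp only [Finset.prod_range]
  have h1 := lintegral_map (μ := μ) hm1 (N.measurable_locationsMarks m)
  simp only [locationsMarks] at h1
  rw [← h1]
  change ∫⁻ p, _ ∂(μ.map (N.locationsMarks m)) = _
  rw [N.map_locationsMarks m, lintegral_withDensity_eq_lintegral_mul _ hm2 hm1,
    lintegral_prod _ (hm2.mul hm1).aemeasurable,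
    lintegral_map (hm2.mul hm1).lintegral_prod_right' N.measurable_locations]
  refine lintegral_congr fun ω => ?_
  simp only [Pi.mul_apply, ← Finset.prod_mul_distrib]
  rw [lintegral_fin_prod_eq_prod P.baseLaw (f := fun i a =>
      P.markDensity (N.X i ω) a * φ (N.X i ω) a) fun i => (hw' _).mul (hφ_meas _)]
  simp only [P.lintegral_markLaw _ (hφ_meas _)]

/-- Any measurable function of the locations and marks, obtained as a sum over the interferers, is
independent of the typical link. -/
lemma indepFun_tsum {c : Plane → Mark → ℝ≥0∞} (hc : Measurable (Function.uncurry c)) :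
    IndepFun (fun ω => ∑' i, c (N.X i ω) (N.mark i ω)) N.typical μ := by
  set σ : ℕ → MeasurableSpace Ω := fun m =>
    MeasurableSpace.comap (N.locationsMarks m) inferInstance
  have hσ : Monotone σ := by
    intro m m' hmm'
    have h : N.locationsMarks m
        = (fun p : (ℕ → Plane) × (Fin m' → Mark) => (p.1, fun i : Fin m => p.2 (Fin.castLE hmm' i)))
          ∘ N.locationsMarks m' := rfl
    simp only [σ]
    rw [h, ← MeasurableSpace.comap_comp]
    refine MeasurableSpace.comap_mono (Measurable.comap_le ?_)
    fun_prop
  -- Independence passes to the supremum of the increasing σ-algebras `σ m`. Every term of the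
  -- series, hence its sum, is measurable for that supremum.
  have hI := indep_iSup_of_monotone (m := σ) (fun m => N.indepFun_locationsMarks m)
    (fun m => (N.measurable_locationsMarks m).comap_le) N.measurable_typical.comap_le hσ
  have h1 : ∀ i, Measurable[σ (i + 1)] fun ω => c (N.X i ω) (N.mark i ω) := by
    intro i
    have h2 : Measurable fun p : (ℕ → Plane) × (Fin (i + 1) → Mark) =>
        c (p.1 i) (p.2 (Fin.last i)) :=
      hc.comp (by fun_prop :
        Measurable fun p : (ℕ → Plane) × (Fin (i + 1) → Mark) => (p.1 i, p.2 (Fin.last i)))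
    exact h2.comp (comap_measurable (N.locationsMarks (i + 1)))
  have h2 : ∀ i, Measurable[⨆ m, σ m] fun ω => c (N.X i ω) (N.mark i ω) := fun i =>
    (h1 i).mono (le_iSup σ (i + 1)) le_rfl
  refine indep_of_indep_of_le_left hI (Measurable.comap_le ?_)
  let _ : MeasurableSpace Ω := ⨆ m, σ m
  exact Measurable.tsum h2

end Network

/-! ### Convergence of the exponents and the Laplace transform of one interferer -/

lemma one_sub_one_div_pow_nonneg {t : ℝ} (ht : 0 ≤ t) (N : ℕ) : 0 ≤ 1 - 1 / (1 + t) ^ N := by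
  rw [sub_nonneg]
  exact div_le_one_of_le₀ (one_le_pow₀ (by linarith)) (by positivity)

lemma one_sub_one_div_pow_le_one {t : ℝ} (ht : 0 ≤ t) (N : ℕ) : 1 - 1 / (1 + t) ^ N ≤ 1 := by
  rw [sub_le_self_iff]
  positivity

/-- Bernoulli's inequality. It gives the decay of the NLOS integrand at infinity. -/
lemma one_sub_one_div_pow_le {t : ℝ} (ht : 0 ≤ t) (N : ℕ) : 1 - 1 / (1 + t) ^ N ≤ N * t := by
  have h1 : 0 ≤ 1 / (1 + t) := by positivity
  have h := one_add_mul_le_pow (a := 1 / (1 + t) - 1) (by linarith) N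
  rw [add_sub_cancel, div_pow, one_pow] at h
  have h2 : 1 - 1 / (1 + t) ≤ t := by
    rw [one_sub_div (by positivity), div_le_iff₀ (by positivity)]
    nlinarith
  nlinarith [mul_le_mul_of_nonneg_left h2 (Nat.cast_nonneg (α := ℝ) N)]

namespace Params

variable (P : Params)

lemma gain_nonneg (i : Lobes) : 0 ≤ P.gain i := by
  have h1 := P.G_pos.le
  have h2 := P.g_nonneg
  cases i <;> simp only [gain] <;> positivity

lemma G0_pos : 0 < P.G0 := mul_pos P.G_pos P.G_pos

lemma Nh_cast_pos : (0 : ℝ) < P.Nh := by exact_mod_cast P.Nh_pos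

lemma K_pos (b : Bool) : 0 < P.K b := by
  have := P.a_pos
  have := P.Pt_pos
  have := P.G0_pos
  have := P.A_pos
  have := P.r_pos
  unfold K
  positivity

lemma K_mul_gain (b : Bool) (i : Lobes) : P.K b * (P.Pt * P.gain i * P.A) = P.Q b i := by
  have := P.Pt_pos.ne'
  have := P.G0_pos.ne'
  have := P.A_pos.ne'
  unfold K Q
  field_simp

lemma Q_nonneg (b : Bool) (i : Lobes) : 0 ≤ P.Q b i := by
  have := P.a_pos
  have := P.G0_pos
  have := P.r_pos
  have := P.gain_nonneg i
  unfold Q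
  positivity

lemma measurable_integrand (T : ℝ) (n : ℕ) (b₀ b : Bool) (i : Lobes) :
    Measurable (P.integrand T n b₀ b i) := by
  have := (P.continuous_stateProb b).measurable
  unfold integrand
  fun_prop

/-- The integrals defining the exponents converge. -/
lemma integrableOn_integrand {T : ℝ} (hT : 0 ≤ T) (n : ℕ) (b₀ b : Bool) (i : Lobes) :
    IntegrableOn (P.integrand T n b₀ b i) (Set.Ioi 0) := by
  have hN := P.Nh_cast_pos
  have hQ := P.Q_nonneg b₀ i
  have hm := (P.measurable_integrand T n b₀ b i).aestronglyMeasurable (μ := volume)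
  have ht : ∀ x : ℝ, 0 < x → 0 ≤ n * P.Q b₀ i * T / (x ^ P.pathLoss b * P.Nh) := fun x hx => by
    positivity
  have hnorm : ∀ x : ℝ, 0 < x → ‖P.integrand T n b₀ b i x‖ = P.integrand T n b₀ b i x :=
    fun x hx => Real.norm_of_nonneg (mul_nonneg (mul_nonneg
      (one_sub_one_div_pow_nonneg (ht x hx) _) (P.stateProb_nonneg b hx.le)) hx.le)
  have hle : ∀ x : ℝ, 0 < x → P.integrand T n b₀ b i x ≤ P.stateProb b x * x := fun x hx => by
    refine mul_le_mul_of_nonneg_right ?_ hx.le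
    exact mul_le_of_le_one_left (P.stateProb_nonneg b hx.le)
      (one_sub_one_div_pow_le_one (ht x hx) _)
  cases b
  -- NLOS: on `(0, 1]` the integrand is at most `1`; beyond, Bernoulli's inequality bounds it by a
  -- multiple of `x ^ (1 - αN)`, integrable because `αN > 2`.
  · rw [← Set.Ioc_union_Ioi_eq_Ioi zero_le_one]
    refine IntegrableOn.union ?_ ?_
    · refine Measure.integrableOn_of_bounded (M := 1) (by simp) hm ?_
      refine (ae_restrict_iff' measurableSet_Ioc).2 (Eventually.of_forall fun x hx => ?_)
      rw [hnorm x hx.1]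
      exact (hle x hx.1).trans (mul_le_one₀ (P.stateProb_le_one _ hx.1.le) hx.1.le hx.2)
    · have h := (integrableOn_Ioi_rpow_of_lt (a := 1 - P.αN) (by linarith [P.αN_gt])
        one_pos).const_mul (n * P.Q b₀ i * T)
      refine Integrable.mono' h hm.restrict ?_
      refine (ae_restrict_iff' measurableSet_Ioi).2 (Eventually.of_forall fun x hx => ?_)
      have hx0 : (0 : ℝ) < x := one_pos.trans hx
      rw [hnorm x hx0]
      have h1 := one_sub_one_div_pow_le (ht x hx0) P.Nh
      calc P.integrand T n b₀ false i x
          ≤ P.Nh * (n * P.Q b₀ i * T / (x ^ P.pathLoss false * P.Nh)) * 1 * x := by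
            refine mul_le_mul_of_nonneg_right ?_ hx0.le
            exact mul_le_mul h1 (P.stateProb_le_one _ hx0.le) (P.stateProb_nonneg _ hx0.le)
              (mul_nonneg hN.le (ht x hx0))
        _ = n * P.Q b₀ i * T * x ^ (1 - P.αN) := by
            rw [Real.rpow_sub hx0, Real.rpow_one]
            simp only [pathLoss]
            field_simp
            simp
  -- LOS: the blockage probability alone gives the bound `x * exp (-β x)`, whatever the value of
  -- `αL`.
  · have h := integrableOn_rpow_mul_exp_neg_mul_rpow (p := 1) (s := 1) (by norm_num) one_pos P.β_pos
    refine Integrable.mono' h hm.restrict ?_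
    refine (ae_restrict_iff' measurableSet_Ioi).2 (Eventually.of_forall fun x hx => ?_)
    rw [hnorm x hx]
    refine (hle x hx).trans (le_of_eq ?_)
    simp [stateProb, losProb, mul_comm]

instance (x : Plane) : IsFiniteMeasure (P.markLaw x) := by
  unfold markLaw
  infer_instance

/-- The power received from an interferer at `x` with mark `a`. -/
def power (x : Plane) (a : Mark) : ℝ≥0∞ :=
  ENNReal.ofReal (P.Pt * P.gain a.2.1 * a.2.2 * P.A * ‖x‖ ^ (-P.pathLoss a.1))

lemma measurable_power : Measurable (Function.uncurry P.power) := by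
  have h1 : Measurable fun p : Plane × Mark => P.gain p.2.2.1 :=
    (measurable_of_countable P.gain).comp (by fun_prop)
  have h2 : Measurable fun p : Plane × Mark => P.pathLoss p.2.1 :=
    (measurable_of_countable P.pathLoss).comp (by fun_prop)
  have h3 : Measurable fun p : Plane × Mark =>
      P.Pt * P.gain p.2.2.1 * p.2.2.2 * P.A * ‖p.1‖ ^ (-P.pathLoss p.2.1) := by fun_prop
  exact h3.ennreal_ofReal

/-- The Laplace transform at `s` of the power received from an interferer at distance `ρ`. -/
def powerLaplace (s ρ : ℝ) : ℝ :=
  ∑ b, P.stateProb b ρ * ∑ i, P.gainProb i *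
    (1 / (1 + s * (P.Pt * P.gain i * P.A) * ρ ^ (-P.pathLoss b) / P.Nh) ^ P.Nh)

lemma measurable_powerLaplace (s : ℝ) : Measurable (P.powerLaplace s) := by
  have := fun b => (P.continuous_stateProb b).measurable
  unfold powerLaplace
  fun_prop

/-- The constant `1` is written as the total mass of the states and gains, so that the subtraction
can be carried out term by term. -/
lemma one_sub_powerLaplace (s ρ : ℝ) : 1 - P.powerLaplace s ρ
    = ∑ b, ∑ i, P.gainProb i * ((1 - 1 / (1 + s * (P.Pt * P.gain i * P.A)
        * ρ ^ (-P.pathLoss b) / P.Nh) ^ P.Nh) * P.stateProb b ρ) := by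
  have h : (1 : ℝ) = ∑ b, P.stateProb b ρ * ∑ i, P.gainProb i * 1 := by
    simp only [mul_one, sum_gainProb, sum_stateProb]
  rw [powerLaplace]
  nth_rw 1 [h]
  rw [← Finset.sum_sub_distrib]
  refine Finset.sum_congr rfl fun b _ => ?_
  rw [← mul_sub, ← Finset.sum_sub_distrib, Finset.mul_sum]
  refine Finset.sum_congr rfl fun i _ => ?_
  ring

lemma integral_expNeg_fadingLaw {t : ℝ} (ht : 0 ≤ t) :
    ∫ h, expNeg (ENNReal.ofReal (t * h)) ∂P.fadingLaw = 1 / (1 + t / P.Nh) ^ P.Nh := by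
  have hN := P.Nh_cast_pos
  have h1 : ∀ᵐ h ∂P.fadingLaw, expNeg (ENNReal.ofReal (t * h)) = Real.exp (-(t * h)) := by
    filter_upwards [ae_nonneg_gammaMeasure P.Nh P.Nh] with h hh
    exact expNeg_ofReal (mul_nonneg ht hh)
  rw [integral_congr_ae h1, fadingLaw, integral_exp_neg_mul_gammaMeasure hN hN ht,
    Real.rpow_natCast, one_div, ← inv_pow]
  congr 1
  field_simp

lemma integral_expNeg_power {s : ℝ} (hs : 0 ≤ s) (x : Plane) :
    ∫ a, expNeg (ENNReal.ofReal s * P.power x a) ∂P.markLaw x = P.powerLaplace s ‖x‖ := by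
  have hm : Measurable fun a => ENNReal.ofReal s * P.power x a :=
    (P.measurable_power.comp measurable_prodMk_left).const_mul _
  have hi := integrable_expNeg (P.markLaw x) hm
  have hi' : ∀ b, Integrable (fun c => expNeg (ENNReal.ofReal s * P.power x (b, c)))
      (P.lobesLaw.prod P.fadingLaw) := fun b =>
    integrable_expNeg _ (hm.comp measurable_prodMk_left)
  rw [markLaw, integral_prod _ hi, P.integral_stateLaw (norm_nonneg x), powerLaplace]
  refine Finset.sum_congr rfl fun b _ => ?_
  rw [integral_prod _ (hi' b), P.integral_lobesLaw]
  congr 1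
  refine Finset.sum_congr rfl fun i _ => ?_
  have h0 : 0 ≤ s * (P.Pt * P.gain i * P.A) * ‖x‖ ^ (-P.pathLoss b) := by
    have := P.Pt_pos
    have := P.A_pos
    have := P.gain_nonneg i
    positivity
  rw [← P.integral_expNeg_fadingLaw h0]
  congr 2
  ext h
  rw [power, ← ENNReal.ofReal_mul hs]
  congr 2
  ring

lemma powerLaplace_nonneg {s : ℝ} (hs : 0 ≤ s) (x : Plane) : 0 ≤ P.powerLaplace s ‖x‖ := by
  rw [← P.integral_expNeg_power hs]
  exact integral_nonneg fun _ => expNeg_nonneg _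

lemma powerLaplace_le_one {s : ℝ} (hs : 0 ≤ s) (x : Plane) : P.powerLaplace s ‖x‖ ≤ 1 := by
  rw [← sub_nonneg, one_sub_powerLaplace]
  refine Finset.sum_nonneg fun b _ => Finset.sum_nonneg fun i _ => ?_
  have := P.Pt_pos
  have := P.A_pos
  have := P.gain_nonneg i
  refine mul_nonneg (P.gainProb_nonneg i) (mul_nonneg (one_sub_one_div_pow_nonneg ?_ _)
    (P.stateProb_nonneg b (norm_nonneg x)))
  positivity

/-- The factor `ρ` is the Jacobian of polar coordinates. At `s = n K T` the gain enters through `K *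
(Pt * M * A) = Q`, which gives the integrands of the exponents. -/
lemma mul_one_sub_powerLaplace (T : ℝ) (n : ℕ) (b₀ : Bool) {ρ : ℝ} (hρ : 0 < ρ) :
    ρ * (1 - P.powerLaplace (n * P.K b₀ * T) ρ)
      = ∑ b, ∑ i, P.gainProb i * P.integrand T n b₀ b i ρ := by
  rw [one_sub_powerLaplace, Finset.mul_sum]
  refine Finset.sum_congr rfl fun b _ => ?_
  rw [Finset.mul_sum]
  refine Finset.sum_congr rfl fun i _ => ?_
  rw [integrand, ← P.K_mul_gain, Real.rpow_neg hρ.le]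
  have h : n * P.K b₀ * T * (P.Pt * P.gain i * P.A) * (ρ ^ P.pathLoss b)⁻¹ / P.Nh
      = n * (P.K b₀ * (P.Pt * P.gain i * P.A)) * T / (ρ ^ P.pathLoss b * P.Nh) := by
    rw [← div_eq_mul_inv, div_div]
    ring
  rw [h]
  ring

lemma integrable_one_sub_powerLaplace {T : ℝ} (hT : 0 ≤ T) (n : ℕ) (b₀ : Bool) :
    Integrable fun x : Plane => 1 - P.powerLaplace (n * P.K b₀ * T) ‖x‖ := by
  rw [integrable_fun_norm_addHaar volume (f := fun ρ => 1 - P.powerLaplace (n * P.K b₀ * T) ρ)]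
  have h : IntegrableOn (fun ρ => ∑ b, ∑ i, P.gainProb i * P.integrand T n b₀ b i ρ)
      (Set.Ioi 0) :=
    integrable_finsetSum _ fun b _ => integrable_finsetSum _ fun i _ =>
      (P.integrableOn_integrand hT n b₀ b i).const_mul _
  refine h.congr_fun (fun ρ hρ => ?_) measurableSet_Ioi
  dsimp only
  rw [← P.mul_one_sub_powerLaplace T n b₀ hρ]
  simp

lemma integral_one_sub_powerLaplace {T : ℝ} (hT : 0 ≤ T) (n : ℕ) (b₀ : Bool) :
    ∫ x : Plane, (1 - P.powerLaplace (n * P.K b₀ * T) ‖x‖)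
      = 2 * Real.pi * (P.exponent T n b₀ true + P.exponent T n b₀ false) := by
  rw [integral_fun_norm_addHaar volume (fun ρ => 1 - P.powerLaplace (n * P.K b₀ * T) ρ)]
  have h1 : ∫ ρ in Set.Ioi (0 : ℝ), ρ ^ (Module.finrank ℝ Plane - 1)
        • (1 - P.powerLaplace (n * P.K b₀ * T) ρ)
      = ∫ ρ in Set.Ioi (0 : ℝ), ∑ b, ∑ i, P.gainProb i * P.integrand T n b₀ b i ρ := by
    refine setIntegral_congr_fun measurableSet_Ioi fun ρ hρ => ?_
    rw [← P.mul_one_sub_powerLaplace T n b₀ hρ]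
    simp
  have h2 : ∫ ρ in Set.Ioi (0 : ℝ), ∑ b, ∑ i, P.gainProb i * P.integrand T n b₀ b i ρ
      = P.exponent T n b₀ true + P.exponent T n b₀ false := by
    rw [integral_finsetSum _ fun b _ => integrable_finsetSum _ fun i _ =>
      (P.integrableOn_integrand hT n b₀ b i).const_mul _, Fintype.sum_bool]
    congr 1 <;>
    · rw [integral_finsetSum _ fun i _ => (P.integrableOn_integrand hT n b₀ _ i).const_mul _]
      simp only [integral_const_mul]
      rfl
  -- The constant `2π` arises as the dimension times the area of the unit disc.
  rw [h1, h2, measureReal_def, EuclideanSpace.volume_ball_fin_two]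
  simp [ENNReal.toReal_ofReal Real.pi_pos.le, mul_assoc]

end Params

/-! ### The Laplace transform of the interference -/

/-- The inverse of `expNeg` on `[0, 1]`. -/
def negLog (v : ℝ) : ℝ≥0∞ := if v = 0 then ⊤ else ENNReal.ofReal (-Real.log v)

lemma measurable_negLog : Measurable negLog :=
  Measurable.ite (measurableSet_singleton 0) measurable_const
    Real.measurable_log.neg.ennreal_ofReal

/-- Turns a product of factors in `[0, 1]` into `expNeg` of a sum over points, the form required by
the Laplace functional. The value `⊤` at `0` covers a vanishing factor. -/
lemma expNeg_negLog {v : ℝ} (h0 : 0 ≤ v) (h1 : v ≤ 1) : expNeg (negLog v) = v := by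
  rcases h0.eq_or_lt with rfl | h0
  · simp [negLog]
  · rw [negLog, if_neg h0.ne', expNeg_ofReal (neg_nonneg.2 (Real.log_nonpos h0.le h1)), neg_neg,
      Real.exp_log h0]

namespace Network

variable {P : Params} {Ω : Type*} [MeasurableSpace Ω] {μ : Measure Ω} (N : Network P μ)

lemma interference_eq (ω : Ω) : N.interference ω = ∑' i, P.power (N.X i ω) (N.mark i ω) := rfl

lemma measurable_power_mark (i : ℕ) : Measurable fun ω => P.power (N.X i ω) (N.mark i ω) := by
  have h : Measurable fun ω => (N.X i ω, N.mark i ω) :=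
    (N.measurable_X i).prodMk (N.measurable_mark i)
  have h2 := P.measurable_power.comp h
  simpa only [Function.comp_def, Function.uncurry_apply_pair] using h2

lemma measurable_interference : Measurable N.interference :=
  Measurable.tsum N.measurable_power_mark

variable [IsProbabilityMeasure μ]

/-- Averaging over the marks in the Laplace transform of the interference. -/
lemma integral_expNeg_mul_interference {s : ℝ} (hs : 0 ≤ s) :
    ∫ ω, expNeg (ENNReal.ofReal s * N.interference ω) ∂μ
      = ∫ ω, expNeg (∑' i, negLog (P.powerLaplace s ‖N.X i ω‖)) ∂μ := by
  have hu : Measurable fun x : Plane => negLog (P.powerLaplace s ‖x‖) :=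
    measurable_negLog.comp ((P.measurable_powerLaplace s).comp measurable_norm)
  have hm1 : ∀ i, Measurable fun ω => ENNReal.ofReal s * P.power (N.X i ω) (N.mark i ω) :=
    fun i => (N.measurable_power_mark i).const_mul _
  have hm2 : ∀ i, Measurable fun ω => negLog (P.powerLaplace s ‖N.X i ω‖) :=
    fun i => hu.comp (N.measurable_X i)
  -- For finitely many interferers, `expNeg` of the sum is a product, and conditional independence
  -- averages it factor by factor. The infinite sums follow by letting `m` tend to infinity on both
  -- sides.
  have hfin : ∀ m : ℕ,
      ∫ ω, expNeg (∑ i ∈ Finset.range m, ENNReal.ofReal s * P.power (N.X i ω) (N.mark i ω)) ∂μ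
      = ∫ ω, expNeg (∑ i ∈ Finset.range m, negLog (P.powerLaplace s ‖N.X i ω‖)) ∂μ := by
    intro m
    rw [integral_eq_lintegral_of_nonneg_ae (Eventually.of_forall fun _ => expNeg_nonneg _)
        (measurable_expNeg.comp (Finset.measurable_fun_sum _ fun i _ =>
          hm1 i)).aestronglyMeasurable,
      integral_eq_lintegral_of_nonneg_ae (Eventually.of_forall fun _ => expNeg_nonneg _)
        (measurable_expNeg.comp (Finset.measurable_fun_sum _ fun i _ =>
          hm2 i)).aestronglyMeasurable]
    congr 1
    simp only [expNeg_sum, ENNReal.ofReal_prod_of_nonneg fun _ _ => expNeg_nonneg _]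
    have hφ : Measurable (Function.uncurry fun x a =>
        ENNReal.ofReal (expNeg (ENNReal.ofReal s * P.power x a))) :=
      (measurable_expNeg.comp (P.measurable_power.const_mul _)).ennreal_ofReal
    rw [N.lintegral_prod_mark hφ m]
    refine lintegral_congr fun ω => Finset.prod_congr rfl fun i _ => ?_
    rw [expNeg_negLog (P.powerLaplace_nonneg hs _) (P.powerLaplace_le_one hs _),
      ← P.integral_expNeg_power hs, ofReal_integral_eq_lintegral_ofReal]
    · exact integrable_expNeg _ ((P.measurable_power.comp measurable_prodMk_left).const_mul _)
    · exact Eventually.of_forall fun _ => expNeg_nonneg _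
  have hL := tendsto_integral_expNeg μ
    (f := fun m ω => ∑ i ∈ Finset.range m, ENNReal.ofReal s * P.power (N.X i ω) (N.mark i ω))
    (fun m => Finset.measurable_fun_sum _ fun i _ => hm1 i)
    fun ω => ENNReal.summable.hasSum.tendsto_sum_nat
  have hR := tendsto_integral_expNeg μ
    (f := fun m ω => ∑ i ∈ Finset.range m, negLog (P.powerLaplace s ‖N.X i ω‖))
    (fun m => Finset.measurable_fun_sum _ fun i _ => hm2 i)
    fun ω => ENNReal.summable.hasSum.tendsto_sum_nat
  simp only [hfin] at hL
  simpa only [interference_eq, ENNReal.tsum_mul_left] using tendsto_nhds_unique hL hR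

/-- The Laplace transform of the interference. -/
theorem laplace_interference {T : ℝ} (hT : 0 ≤ T) (n : ℕ) (b₀ : Bool) :
    ∫ ω, expNeg (ENNReal.ofReal (n * P.K b₀ * T) * N.interference ω) ∂μ
      = Real.exp (-(2 * Real.pi * P.intensity
        * (P.exponent T n b₀ true + P.exponent T n b₀ false))) := by
  have hs : 0 ≤ n * P.K b₀ * T := by
    have := P.K_pos b₀
    positivity
  have hu : Measurable fun x : Plane => negLog (P.powerLaplace (n * P.K b₀ * T) ‖x‖) :=
    measurable_negLog.comp ((P.measurable_powerLaplace _).comp measurable_norm)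
  have he : ∀ x : Plane, expNeg (negLog (P.powerLaplace (n * P.K b₀ * T) ‖x‖))
      = P.powerLaplace (n * P.K b₀ * T) ‖x‖ := fun x =>
    expNeg_negLog (P.powerLaplace_nonneg hs x) (P.powerLaplace_le_one hs x)
  rw [N.integral_expNeg_mul_interference hs, N.poisson.integral_expNeg_tsum P.intensity_pos.le hu
    (by simpa only [he] using P.integrable_one_sub_powerLaplace hT n b₀)]
  simp only [he]
  rw [P.integral_one_sub_powerLaplace hT n b₀]
  congr 1
  ring

end Network

/-! ### Coverage given the interference -/

/-- The binomial expansion of `(1 - e) ^ N` without its term `n = 0`, with the signs reversed. -/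
lemma sum_Icc_choose_mul_pow (N : ℕ) (e : ℝ) :
    ∑ n ∈ Finset.Icc 1 N, (N.choose n : ℝ) * (-1) ^ (n + 1) * e ^ n = 1 - (1 - e) ^ N := by
  have h := add_pow (-e) 1 N
  rw [Finset.range_eq_Ico, Finset.sum_eq_sum_Ico_succ_bot (by omega)] at h
  rw [sub_eq_neg_add 1 e, h, zero_add, ← Finset.Ico_add_one_right_eq_Icc]
  simp only [one_pow, mul_one, pow_zero, Nat.choose_zero_right, Nat.cast_one, sub_add_cancel_left,
    ← Finset.sum_neg_distrib]
  refine Finset.sum_congr rfl fun n _ => ?_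
  rw [neg_pow e]
  ring

namespace Params

variable (P : Params)

instance : IsFiniteMeasure P.typicalLaw := by
  unfold typicalLaw
  infer_instance

/-- The pairs of an interference and a typical link for which the SINR is at least `T`. -/
def coverage (T : ℝ) : Set (ℝ≥0∞ × (Bool × ℝ)) :=
  {p | ENNReal.ofReal T ≤ ENNReal.ofReal (P.Pt * P.G0 * p.2.2 * P.A * P.r ^ (-P.pathLoss p.2.1))
    / (ENNReal.ofReal P.N0 + p.1)}

lemma measurableSet_coverage (T : ℝ) : MeasurableSet (P.coverage T) := by
  have h1 : Measurable fun p : ℝ≥0∞ × (Bool × ℝ) => P.r ^ (-P.pathLoss p.2.1) :=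
    (measurable_of_countable fun b => P.r ^ (-P.pathLoss b)).comp (by fun_prop)
  have h2 : Measurable fun p : ℝ≥0∞ × (Bool × ℝ) =>
      P.Pt * P.G0 * p.2.2 * P.A * P.r ^ (-P.pathLoss p.2.1) := by fun_prop
  have h3 : Measurable fun p : ℝ≥0∞ × (Bool × ℝ) => ENNReal.ofReal P.N0 + p.1 := by fun_prop
  exact measurableSet_le measurable_const (h2.ennreal_ofReal.div h3)

/-- The probability of coverage of a link of state `b`, given the interference. -/
def coverageProb (T : ℝ) (b : Bool) (I : ℝ≥0∞) : ℝ :=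
  P.fadingLaw.real {h | (I, (b, h)) ∈ P.coverage T}

lemma coverageProb_top {T : ℝ} (hT : 0 < T) (b : Bool) : P.coverageProb T b ⊤ = 0 := by
  simp [coverageProb, coverage, ENNReal.div_top, not_le.2 hT]

/-- The SINR condition is linear in the fading power and is solved for it. The division by `a` only
compensates the factor `a` contained in `K`. -/
lemma coverageProb_of_ne_top {T : ℝ} (hT : 0 < T) (b : Bool) {I : ℝ≥0∞} (hI : I ≠ ⊤) :
    P.coverageProb T b I
      = P.fadingLaw.real (Set.Ici (P.K b * T * (P.N0 + I.toReal) / P.a)) := by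
  have hN0 := P.N0_pos
  have ha := P.a_pos
  have hPt := P.Pt_pos
  have hG := P.G0_pos
  have hA := P.A_pos
  have hr := Real.rpow_pos_of_pos P.r_pos (P.pathLoss b)
  have hI0 : 0 ≤ I.toReal := ENNReal.toReal_nonneg
  rw [coverageProb]
  congr 1
  ext h
  have h1 : ENNReal.ofReal P.N0 + I = ENNReal.ofReal (P.N0 + I.toReal) := by
    rw [ENNReal.ofReal_add hN0.le hI0, ENNReal.ofReal_toReal hI]
  have hpos : 0 < P.N0 + I.toReal := by positivity
  -- Rules out the degenerate case in which `ENNReal.ofReal` truncates both sides of the comparison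
  -- to `0`.
  have hTp : ¬ T * (P.N0 + I.toReal) ≤ 0 := not_le.2 (by positivity)
  change ENNReal.ofReal T ≤ ENNReal.ofReal (P.Pt * P.G0 * h * P.A * P.r ^ (-P.pathLoss b))
    / (ENNReal.ofReal P.N0 + I) ↔ P.K b * T * (P.N0 + I.toReal) / P.a ≤ h
  rw [h1, ENNReal.le_div_iff_mul_le (Or.inl (by simpa using hpos)) (Or.inl ENNReal.ofReal_ne_top),
    ← ENNReal.ofReal_mul hT.le, ENNReal.ofReal_le_ofReal_iff', or_iff_left hTp,
    Real.rpow_neg P.r_pos.le, ← div_eq_mul_inv, le_div_iff₀ hr, div_le_iff₀ ha, K,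
    div_mul_eq_mul_div, div_mul_eq_mul_div, div_le_iff₀ (by positivity)]
  rw [← mul_le_mul_iff_right₀ ha]
  ring_nf

/-- The upper bound for `coverageProb` obtained from Alzer's inequality. -/
def coverageBound (T : ℝ) (b : Bool) (I : ℝ≥0∞) : ℝ :=
  ∑ n ∈ Finset.Icc 1 P.Nh, (P.Nh.choose n : ℝ) * (-1) ^ (n + 1)
    * Real.exp (-(n * P.K b * T * P.N0)) * expNeg (ENNReal.ofReal (n * P.K b * T) * I)

/-- The sum starts at `n = 1`, so each term contains `exp (-∞)`. Bound and probability thus agree,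
both being `0`, where the interference is infinite. -/
lemma coverageBound_top {T : ℝ} (hT : 0 < T) (b : Bool) : P.coverageBound T b ⊤ = 0 := by
  refine Finset.sum_eq_zero fun n hn => ?_
  have hn : (0 : ℝ) < n := by exact_mod_cast (Finset.mem_Icc.1 hn).1
  have hK := P.K_pos b
  have h : ENNReal.ofReal (n * P.K b * T) ≠ 0 := by
    rw [Ne, ENNReal.ofReal_eq_zero, not_le]
    positivity
  rw [ENNReal.mul_top h, expNeg_top, mul_zero]

lemma coverageBound_of_ne_top {T : ℝ} (hT : 0 < T) (b : Bool) {I : ℝ≥0∞} (hI : I ≠ ⊤) :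
    P.coverageBound T b I
      = 1 - (1 - Real.exp (-(P.a * (P.K b * T * (P.N0 + I.toReal) / P.a)))) ^ P.Nh := by
  have hK := P.K_pos b
  rw [mul_div_cancel₀ _ P.a_pos.ne', ← sum_Icc_choose_mul_pow]
  refine Finset.sum_congr rfl fun n _ => ?_
  rw [expNeg_of_ne_top (ENNReal.mul_ne_top ENNReal.ofReal_ne_top hI), ENNReal.toReal_mul,
    ENNReal.toReal_ofReal (by positivity), mul_assoc _ (Real.exp _), ← Real.exp_add,
    ← Real.exp_nat_mul]
  congr 2
  ring

lemma threshold_pos {T : ℝ} (hT : 0 < T) (b : Bool) (I : ℝ≥0∞) :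
    0 < P.K b * T * (P.N0 + I.toReal) / P.a := by
  have hK := P.K_pos b
  have ha := P.a_pos
  have hN0 := P.N0_pos
  have hI0 : 0 ≤ I.toReal := ENNReal.toReal_nonneg
  positivity

lemma coverageProb_lt {T : ℝ} (hT : 0 < T) (h2 : 2 ≤ P.Nh) (b : Bool) {I : ℝ≥0∞} (hI : I ≠ ⊤) :
    P.coverageProb T b I < P.coverageBound T b I := by
  rw [P.coverageProb_of_ne_top hT b hI, P.coverageBound_of_ne_top hT b hI]
  exact P.fadingLaw_real_Ici_lt h2 (P.threshold_pos hT b I)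

lemma coverageProb_eq {T : ℝ} (hT : 0 < T) (h1 : P.Nh = 1) (b : Bool) (I : ℝ≥0∞) :
    P.coverageProb T b I = P.coverageBound T b I := by
  by_cases hI : I = ⊤
  · rw [hI, P.coverageProb_top hT, P.coverageBound_top hT]
  · rw [P.coverageProb_of_ne_top hT b hI, P.coverageBound_of_ne_top hT b hI]
    exact P.fadingLaw_real_Ici_eq h1 (P.threshold_pos hT b I)

lemma measurable_coverageProb (T : ℝ) (b : Bool) : Measurable (P.coverageProb T b) := by
  have h : Measurable fun p : ℝ≥0∞ × ℝ => (p.1, (b, p.2)) := by fun_prop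
  exact (measurable_measure_prodMk_left (h (P.measurableSet_coverage T))).ennreal_toReal

lemma typicalLaw_real_section (T : ℝ) (I : ℝ≥0∞) :
    P.typicalLaw.real (Prod.mk I ⁻¹' P.coverage T)
      = ∑ b, P.stateProb b P.r * P.coverageProb T b I := by
  have hm : MeasurableSet (Prod.mk I ⁻¹' P.coverage T) :=
    measurable_prodMk_left (P.measurableSet_coverage T)
  rw [measureReal_def, typicalLaw, Measure.prod_apply hm, lintegral_stateLaw, ENNReal.toReal_sum]
  · refine Finset.sum_congr rfl fun b _ => ?_
    rw [ENNReal.toReal_mul, ENNReal.toReal_ofReal (P.stateProb_nonneg b P.r_pos.le)]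
    rfl
  · intro b _
    exact ENNReal.mul_ne_top ENNReal.ofReal_ne_top (measure_ne_top _ _)

lemma stateProb_r_pos (b : Bool) : 0 < P.stateProb b P.r := by
  cases b
  · have h : P.losProb P.r < 1 := by
      rw [losProb, Real.exp_lt_one_iff]
      nlinarith [mul_pos P.β_pos P.r_pos]
    simpa [stateProb] using h
  · simpa [stateProb] using P.losProb_pos P.r

end Params

/-! ### Averaging over the interference -/

namespace Network

variable {P : Params} {Ω : Type*} [MeasurableSpace Ω] {μ : Measure Ω} (N : Network P μ)
  [IsProbabilityMeasure μ]

/-- The probability of coverage, by conditioning on the interference. -/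
lemma ccdf_eq (T : ℝ) : N.ccdf T
    = ∫ ω, ∑ b, P.stateProb b P.r * P.coverageProb T b (N.interference ω) ∂μ := by
  have hind : IndepFun N.interference N.typical μ := N.indepFun_tsum P.measurable_power
  have hI := N.measurable_interference
  -- By independence the joint law is a product, so the coverage probability is the integral of the
  -- sections of `coverage` over the law of the interference.
  have hmap := hind.map_prod_eq_prod_map_map hI.aemeasurable N.measurable_typical.aemeasurable
  have hS := P.measurableSet_coverage T
  have hset : {ω | ENNReal.ofReal T ≤ N.SINR ω}
      = (fun ω => (N.interference ω, N.typical ω)) ⁻¹' P.coverage T := rfl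
  have hms := measurable_measure_prodMk_left (ν := P.typicalLaw) hS
  simp only [← P.typicalLaw_real_section]
  rw [ccdf, hset, measureReal_def, ← Measure.map_apply (hI.prodMk N.measurable_typical) hS, hmap,
    N.map_typical, Measure.prod_apply hS, lintegral_map hms hI]
  exact (integral_toReal (hms.comp hI).aemeasurable
    (Eventually.of_forall fun _ => measure_lt_top _ _)).symm

lemma integrable_coverageBound (T : ℝ) (b : Bool) :
    Integrable (fun ω => P.coverageBound T b (N.interference ω)) μ :=
  integrable_finsetSum _ fun _ _ =>
    (integrable_expNeg μ (N.measurable_interference.const_mul _)).const_mul _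

lemma integrable_coverageProb (T : ℝ) (b : Bool) :
    Integrable (fun ω => P.coverageProb T b (N.interference ω)) μ := by
  refine Integrable.of_bound ((P.measurable_coverageProb T b).comp
    N.measurable_interference).aestronglyMeasurable 1 (Eventually.of_forall fun ω => ?_)
  rw [Params.coverageProb, Real.norm_of_nonneg measureReal_nonneg]
  exact measureReal_le_one

lemma ccdfBound_eq {T : ℝ} (hT : 0 < T) : P.ccdfBound T
    = ∫ ω, ∑ b, P.stateProb b P.r * P.coverageBound T b (N.interference ω) ∂μ := by
  have h : ∀ b, ∫ ω, P.coverageBound T b (N.interference ω) ∂μ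
      = ∑ n ∈ Finset.Icc 1 P.Nh, (P.Nh.choose n : ℝ) * (-1) ^ (n + 1)
        * Real.exp (-(n * P.K b * T * P.N0)) * Real.exp (-(2 * Real.pi * P.intensity
          * (P.exponent T n b true + P.exponent T n b false))) := by
    intro b
    simp only [Params.coverageBound]
    rw [integral_finsetSum _ fun n _ =>
      (integrable_expNeg μ (N.measurable_interference.const_mul _)).const_mul _]
    refine Finset.sum_congr rfl fun n _ => ?_
    rw [integral_const_mul, N.laplace_interference hT.le]
  rw [integral_finsetSum _ fun b _ => (N.integrable_coverageBound T b).const_mul _]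
  simp only [integral_const_mul, h, Fintype.sum_bool]
  rw [Params.ccdfBound, mul_comm, mul_comm (Finset.sum _ _) (1 - P.losProb P.r)]
  rfl

/-- The interference is finite with positive probability. -/
lemma measure_interference_ne_top_pos : 0 < μ {ω | N.interference ω ≠ ⊤} := by
  rw [pos_iff_ne_zero]
  intro h0
  have htop : ∀ᵐ ω ∂μ, N.interference ω = ⊤ := by
    rw [ae_iff]
    exact h0
  -- If the interference were almost surely infinite, its Laplace transform at `K_L` would be `0`;
  -- yet it is the exponential of a real number.
  have h := N.laplace_interference zero_le_one 1 true
  have hz : ∀ᵐ ω ∂μ, expNeg (ENNReal.ofReal ((1 : ℕ) * P.K true * 1) * N.interference ω) = 0 := by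
    filter_upwards [htop] with ω hω
    have hK : ENNReal.ofReal ((1 : ℕ) * P.K true * 1) ≠ 0 := by
      simpa using P.K_pos true
    rw [hω, ENNReal.mul_top hK, expNeg_top]
  rw [integral_congr_ae hz, integral_zero] at h
  exact (Real.exp_pos _).ne h

/-- The integrands satisfy the strict inequality wherever the interference is finite and coincide
elsewhere, so it suffices that finiteness has positive probability. -/
theorem ccdf_lt_ccdfBound {T : ℝ} (hT : 0 < T) (h2 : 2 ≤ P.Nh) : N.ccdf T < P.ccdfBound T := by
  have hi1 : Integrable (fun ω => ∑ b, P.stateProb b P.r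
      * P.coverageBound T b (N.interference ω)) μ :=
    integrable_finsetSum _ fun b _ => (N.integrable_coverageBound T b).const_mul _
  have hi2 : Integrable (fun ω => ∑ b, P.stateProb b P.r
      * P.coverageProb T b (N.interference ω)) μ :=
    integrable_finsetSum _ fun b _ => (N.integrable_coverageProb T b).const_mul _
  rw [N.ccdf_eq T, N.ccdfBound_eq hT, ← sub_pos, ← integral_sub hi1 hi2]
  have hpos : ∀ ω, N.interference ω ≠ ⊤ → 0 < ∑ b, P.stateProb b P.r
      * P.coverageBound T b (N.interference ω)
      - ∑ b, P.stateProb b P.r * P.coverageProb T b (N.interference ω) := by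
    intro ω hω
    rw [sub_pos]
    exact Finset.sum_lt_sum_of_nonempty Finset.univ_nonempty fun b _ =>
      mul_lt_mul_of_pos_left (P.coverageProb_lt hT h2 b hω) (P.stateProb_r_pos b)
  refine (integral_pos_iff_support_of_nonneg ?_ (hi1.sub hi2)).2 ?_
  · intro ω
    by_cases hω : N.interference ω = ⊤
    · simp only [Pi.sub_apply, Pi.zero_apply, hω, P.coverageBound_top hT, P.coverageProb_top hT,
        sub_self, le_refl]
    · exact (hpos ω hω).le
  · exact N.measure_interference_ne_top_pos.trans_le (measure_mono fun ω hω => (hpos ω hω).ne')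

theorem ccdf_eq_ccdfBound {T : ℝ} (hT : 0 < T) (h1 : P.Nh = 1) : N.ccdf T = P.ccdfBound T := by
  rw [N.ccdf_eq T, N.ccdfBound_eq hT]
  simp only [P.coverageProb_eq hT h1]

end Network

end MmWave

end

theorem theorem1 (P : MmWave.Params) {Ω : Type*} [MeasurableSpace Ω] (μ : Measure Ω)
    [IsProbabilityMeasure μ] (N : MmWave.Network P μ) (T : ℝ) (hT : 0 < T) :
    (∀ (n : ℕ) (los₀ los : Bool) (i : MmWave.Lobes),
      IntegrableOn (P.integrand T n los₀ los i) (Set.Ioi 0)) ∧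
    (2 ≤ P.Nh → N.ccdf T < P.ccdfBound T) ∧
    (P.Nh = 1 → N.ccdf T = P.ccdfBound T) := by
  exact ⟨fun n b₀ b i => P.integrableOn_integrand hT.le n b₀ b i, N.ccdf_lt_ccdfBound hT,
    N.ccdf_eq_ccdfBound hT⟩
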